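/- Consider simple undirected graphs $G$ on $n$ vertices in the adjacency-matrix model: a quantum query algorithm making $T$ queries applies $U_0, O_G, U_1, O_G, \dots, O_G, U_T$ to a fixed initial state, where the $U_i$ are unitaries independent of $G$ and $O_G\lvert\{u,v\}\rangle\lvert q\rangle=\lvert\{u,v\}\rangle\lvert q\oplus E_G(u,v)\rangle$ with $E_G(u,v)=1$ if and only if $uv$ is an edge of $G$ (possibly acting on part of the qubits), and then measures. The bounded-error quantum query complexity of a graph property is the least $T$ for which some such algorithm answers correctly with probability at least $2/3$ on every $n$-vertex graph. For every constant $C$ there are constants $c_1,c_2>0$, depending only on $C$, such that for all integers $n,k$ with $1\le k<n-1$ and $k\le C\sqrt n$, the bounded-error quantum query complexity $Q$ of deciding whether an $n$-vertex graph has a vertex cover of size at most $k$ satisfies $$c_1\sqrt{k}\,n\le Q\le c_2\sqrt{k}\,n,$$ that is, $Q=\Theta(\sqrt k\,n)$ when $k=O(\sqrt n)$. With the same constants, the same bounds hold for the bounded-error quantum query complexity of deciding whether an $n$-vertex graph has a clique of size at least $n-k$. -/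

import Mathlib

open scoped Matrix

/-- The computational basis of a quantum query algorithm: a query register holding an index,
a target bit, and a workspace of finite dimension `w`. -/
abbrev QueryBasis (ι : Type) (w : ℕ) : Type := ι × Bool × Fin w

/-- The query operator of the input `x`: it sends `|i⟩|q⟩|z⟩` to `|i⟩|q ⊕ x i⟩|z⟩`
(see `queryOp_single`). -/
def queryOp {ι : Type} {w : ℕ} (x : ι → Bool) (ψ : QueryBasis ι w → ℂ) :
    QueryBasis ι w → ℂ :=
  fun b => ψ (b.1, xor b.2.1 (x b.1), b.2.2)

/-- The query operator acts on basis states as `|i⟩|q⟩|z⟩ ↦ |i⟩|q ⊕ x i⟩|z⟩`. -/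
theorem queryOp_single {ι : Type} [DecidableEq ι] {w : ℕ} (x : ι → Bool)
    (i : ι) (q : Bool) (z : Fin w) :
    queryOp x (Pi.single ((i, q, z) : QueryBasis ι w) (1 : ℂ)) =
      Pi.single ((i, xor q (x i), z) : QueryBasis ι w) (1 : ℂ) := by
  funext b
  obtain ⟨j, r, y⟩ := b
  simp only [queryOp, Pi.single_apply, Prod.mk.injEq]
  by_cases hj : j = i
  · subst hj
    cases r <;> cases q <;> cases x j <;> simp
  · simp [hj]

/-- A quantum query algorithm `U₀, O, U₁, O, …, O, U_T` (with `T = queries`) on inputs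
`x : ι → Bool`. The unitaries do not depend on the input; only `U 0, …, U queries` are used.
The algorithm starts in a fixed basis state, and at the end the state is measured in the
computational basis and a Boolean answer is read off from the measured basis element. -/
structure QuantumQueryAlgorithm (ι : Type) [Fintype ι] [DecidableEq ι] where
  /-- The number of oracle calls. -/
  queries : ℕ
  /-- The dimension of the workspace. -/
  w : ℕ
  /-- The input-independent unitary operators. -/
  U : ℕ → Matrix.unitaryGroup (QueryBasis ι w) ℂ
  /-- The initial basis state. -/
  start : QueryBasis ι w
  /-- The answer attached to a measurement outcome. -/
  output : QueryBasis ι w → Bool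

namespace QuantumQueryAlgorithm

variable {ι : Type} [Fintype ι] [DecidableEq ι]

/-- The state `U_t O U_{t-1} O ⋯ O U₀ |start⟩` of the algorithm on the input `x`. -/
def state (A : QuantumQueryAlgorithm ι) (x : ι → Bool) : ℕ → QueryBasis ι A.w → ℂ
  | 0 => (A.U 0 : Matrix (QueryBasis ι A.w) (QueryBasis ι A.w) ℂ) *ᵥ Pi.single A.start 1
  | t + 1 => (A.U (t + 1) : Matrix (QueryBasis ι A.w) (QueryBasis ι A.w) ℂ) *ᵥ
      queryOp x (A.state x t)

/-- The probability that the algorithm answers `a` on the input `x`. -/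
noncomputable def answerProb (A : QuantumQueryAlgorithm ι) (x : ι → Bool) (a : Bool) : ℝ :=
  ∑ b : QueryBasis ι A.w, if A.output b = a then ‖A.state x A.queries b‖ ^ 2 else 0

end QuantumQueryAlgorithm

/-- The unordered pairs of distinct vertices: the indices of the adjacency matrix. -/
abbrev VertexPair (n : ℕ) : Type := {e : Sym2 (Fin n) // ¬ e.IsDiag}

open Classical in
/-- The adjacency-matrix oracle of a graph: `1` exactly on the edges. -/
noncomputable def adjOracle {n : ℕ} (G : SimpleGraph (Fin n)) : VertexPair n → Bool :=
  fun e => decide ((e : Sym2 (Fin n)) ∈ G.edgeSet)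

open Classical in
/-- The algorithm decides the graph property `P` with bounded error: on every graph with `n`
vertices, its answer is correct with probability at least `2/3`. -/
def DecidesGraphProperty {n : ℕ} (A : QuantumQueryAlgorithm (VertexPair n))
    (P : SimpleGraph (Fin n) → Prop) : Prop :=
  ∀ G : SimpleGraph (Fin n), 2 / 3 ≤ A.answerProb (adjOracle G) (decide (P G))

/-- The bounded-error quantum query complexity of the graph property `P` in the adjacency-matrix
model: the least number of queries of an algorithm that decides `P` with bounded error. (The
infimum of the empty set is `0`, so a positive lower bound also says that an algorithm exists.) -/
noncomputable def quantumQueryComplexity {n : ℕ} (P : SimpleGraph (Fin n) → Prop) : ℕ :=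
  sInf {T : ℕ | ∃ A : QuantumQueryAlgorithm (VertexPair n),
    A.queries = T ∧ DecidesGraphProperty A P}

/-- The graph has a vertex cover of size at most `k`. -/
def HasVertexCoverLE {n : ℕ} (k : ℕ) (G : SimpleGraph (Fin n)) : Prop :=
  ∃ S : Finset (Fin n), S.card ≤ k ∧ G.IsVertexCover (S : Set (Fin n))

/-- The graph has a clique of size at least `m`. -/
def HasCliqueGE {n : ℕ} (m : ℕ) (G : SimpleGraph (Fin n)) : Prop :=
  ∃ S : Finset (Fin n), m ≤ S.card ∧ G.IsClique (S : Set (Fin n))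

/-! Upper bound. A dual adversary solution of value `W ≥ 1` is turned into an algorithm with about
`3W` queries (`DualAdversary.exists_algorithm`). Such solutions are composed along a classical
decision tree, where a query costs `g` if the answer is `false` and `g⁻¹` if it is `true`
(`DualAdversary.query`). A tree with at most `a` zero answers and `b` one answers on each path thus
costs `a g + b g⁻¹`, about `√(ab)` for the best `g`.

The tree has two phases. A greedy maximal matching is found by scanning all vertex pairs; `k + 1`
disjoint edges rule out a cover of size `k`, so there are at most `k + 1` ones among `n²` pairs, at
cost `O(√k n)` (`dualAdversary_of_matching`). Otherwise the at most `2k` matched vertices form a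
vertex cover, and up to `k + 1` neighbours of each are learnt (`dualAdversary_of_cover`); a vertex
with `k + 1` neighbours lies in every small cover, so nothing more is needed. This costs `O(k^{3/2}
√n)`, which is `O(√k n)` exactly because `k = O(√n)`.

The algorithm iterates a query followed by a fixed unitary containing a reflection. Its initial
state overlaps well with an invariant vector on yes-inputs, while on no-inputs its orbit sums
telescope. Instead of phase estimation, the algorithm averages the iterates over a uniform clock
register.

Lower bound. The positive adversary method (`card_le_queries_mul`) compares matchings with `k` edges
to matchings with `k + 1` edges, related by removing one edge (`queries_ge_of_decides`). When `n` is
bounded in terms of `C`, one query is enough for the bound (`queries_pos_of_decides`).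

Cliques reduce to vertex covers by complementing the graph, which costs no queries. -/

/-! ### Unitary matrices: isometries, state preparation, block structure -/

open WithLp in
theorem LinearIsometryEquiv.exists_unitaryGroup_mulVec {B : Type*} [Fintype B] [DecidableEq B]
    (e : EuclideanSpace ℂ B ≃ₗᵢ[ℂ] EuclideanSpace ℂ B) :
    ∃ M : Matrix.unitaryGroup B ℂ, ∀ v : B → ℂ, (M : Matrix B B ℂ) *ᵥ v = ofLp (e (toLp 2 v)) := by
  have hu := (Unitary.linearIsometryEquiv.symm e).2
  set u := (Unitary.linearIsometryEquiv.symm e).1 with hu'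
  obtain ⟨M, hM⟩ := EquivLike.surjective (Matrix.toEuclideanCLM (n := B) (𝕜 := ℂ)) u
  refine ⟨⟨M, ?_⟩, fun v => ?_⟩
  · rw [Matrix.mem_unitaryGroup_iff]
    apply EquivLike.injective (Matrix.toEuclideanCLM (n := B) (𝕜 := ℂ))
    rw [map_mul, map_star, hM, map_one, Unitary.mul_star_self_of_mem hu]
  · rw [← Matrix.ofLp_toEuclideanCLM M (toLp 2 v), hM]
    rfl

-- State preparation: a unit vector extends to an orthonormal basis, and the change of basis is
-- unitary.
open WithLp in
theorem Matrix.exists_unitaryGroup_mulVec_single {B : Type*} [Fintype B] [DecidableEq B]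
    (v : B → ℂ) (hv : ∑ b, ‖v b‖ ^ 2 = 1) (b₀ : B) :
    ∃ M : Matrix.unitaryGroup B ℂ, (M : Matrix B B ℂ) *ᵥ Pi.single b₀ 1 = v := by
  have hn : ‖(toLp 2 v : EuclideanSpace ℂ B)‖ = 1 := by
    rw [EuclideanSpace.norm_eq]; simp [hv]
  have ho : Orthonormal ℂ (({b₀} : Set B).domRestrict
      (fun _ : B => (toLp 2 v : EuclideanSpace ℂ B))) := by
    refine ⟨fun _ => hn, fun i j hij => (hij ?_).elim⟩
    exact Subsingleton.elim _ _
  obtain ⟨b, hb⟩ := ho.exists_orthonormalBasis_extension_of_card_eq (by simp)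
  obtain ⟨M, hM⟩ := (b.repr.symm).exists_unitaryGroup_mulVec
  refine ⟨M, ?_⟩
  have h2 : (toLp 2 (Pi.single b₀ (1 : ℂ)) : EuclideanSpace ℂ B) = EuclideanSpace.single b₀ 1 := rfl
  rw [hM, h2, OrthonormalBasis.repr_symm_single, hb b₀ rfl]

theorem Matrix.sum_norm_sq_unitaryGroup_mulVec {B : Type*} [Fintype B] [DecidableEq B]
    (M : Matrix.unitaryGroup B ℂ) (v : B → ℂ) :
    ∑ b, ‖((M : Matrix B B ℂ) *ᵥ v) b‖ ^ 2 = ∑ b, ‖v b‖ ^ 2 := by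
  have key : ∀ w : B → ℂ, ((∑ b, ‖w b‖ ^ 2 : ℝ) : ℂ) = star w ⬝ᵥ w := by
    intro w
    simp [dotProduct, Complex.conj_mul']
  have : ((∑ b, ‖((M : Matrix B B ℂ) *ᵥ v) b‖ ^ 2 : ℝ) : ℂ) = ((∑ b, ‖v b‖ ^ 2 : ℝ) : ℂ) := by
    rw [key, key, Matrix.star_mulVec, Matrix.dotProduct_mulVec, Matrix.vecMul_vecMul,
      ← Matrix.star_eq_conjTranspose, Matrix.UnitaryGroup.star_mul_self, Matrix.vecMul_one]
  exact_mod_cast this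

theorem Matrix.reindex_mem_unitaryGroup {B B' : Type*} [Fintype B] [DecidableEq B] [Fintype B']
    [DecidableEq B'] (σ : B ≃ B') {M : Matrix B B ℂ} (hM : M ∈ Matrix.unitaryGroup B ℂ) :
    Matrix.reindex σ σ M ∈ Matrix.unitaryGroup B' ℂ := by
  rw [Matrix.mem_unitaryGroup_iff] at hM ⊢
  rw [Matrix.star_eq_conjTranspose, Matrix.reindex_apply, Matrix.conjTranspose_submatrix,
    Matrix.submatrix_mul_equiv, ← Matrix.star_eq_conjTranspose, hM, Matrix.submatrix_one_equiv]

theorem Matrix.reindex_mulVec_apply {B B' : Type*} [Fintype B] [Fintype B']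
    (σ : B ≃ B') (M : Matrix B B ℂ) (v : B' → ℂ) (b : B) :
    (Matrix.reindex σ σ M *ᵥ v) (σ b) = (M *ᵥ (v ∘ σ)) b := by
  simp only [Matrix.reindex_apply, Matrix.mulVec, dotProduct, Matrix.submatrix_apply,
    Equiv.symm_apply_apply, Function.comp]
  rw [← Equiv.sum_comp σ]
  simp

theorem Matrix.blockDiagonal_mem_unitaryGroup {B K : Type*} [Fintype B] [DecidableEq B]
    [Fintype K] [DecidableEq K] (M : K → Matrix.unitaryGroup B ℂ) :
    Matrix.blockDiagonal (fun k => (M k : Matrix B B ℂ)) ∈ Matrix.unitaryGroup (B × K) ℂ := by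
  rw [Matrix.mem_unitaryGroup_iff, Matrix.star_eq_conjTranspose, Matrix.blockDiagonal_conjTranspose,
    ← Matrix.blockDiagonal_mul, ← Matrix.blockDiagonal_one]
  congr 1
  funext k
  exact Matrix.mem_unitaryGroup_iff.mp (M k).2

theorem Matrix.blockDiagonal_mulVec_apply {B K : Type*} [Fintype B]
    [Fintype K] [DecidableEq K] (M : K → Matrix B B ℂ) (v : B × K → ℂ) (b : B) (k : K) :
    (Matrix.blockDiagonal M *ᵥ v) (b, k) = (M k *ᵥ fun b' => v (b', k)) b := by
  simp [Matrix.mulVec, dotProduct, Fintype.sum_prod_type, Matrix.blockDiagonal_apply, ite_mul]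

theorem Matrix.one_kronecker_mulVec_apply {B K : Type*} [Fintype B] [DecidableEq B]
    [Fintype K] (M : Matrix K K ℂ) (v : B × K → ℂ) (b : B) (k : K) :
    (Matrix.kroneckerMap (· * ·) (1 : Matrix B B ℂ) M *ᵥ v) (b, k) = ∑ k', M k k' * v (b, k') := by
  simp only [Matrix.mulVec, dotProduct, Fintype.sum_prod_type, Matrix.kroneckerMap_apply,
    Matrix.one_apply, ite_mul, one_mul, zero_mul]
  rw [Finset.sum_eq_single b] <;> simp +contextual [eq_comm]

/-! ### Running an iteration for a superposition of times -/

/-- The query operator with an arbitrary workspace `κ`. -/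
def bitOracle {ι κ : Type} (x : ι → Bool) (ψ : ι × Bool × κ → ℂ) : ι × Bool × κ → ℂ :=
  fun b => ψ (b.1, xor b.2.1 (x b.1), b.2.2)

/-- The permutation of the computational basis made by a query. -/
def bitOraclePerm {ι κ : Type} (x : ι → Bool) : Equiv.Perm (ι × Bool × κ) where
  toFun b := (b.1, xor b.2.1 (x b.1), b.2.2)
  invFun b := (b.1, xor b.2.1 (x b.1), b.2.2)
  left_inv b := by simp
  right_inv b := by simp

namespace QuantumQueryAlgorithm

variable {ι : Type} [Fintype ι] [DecidableEq ι]

omit [DecidableEq ι] in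
theorem sum_norm_sq_queryOp {w : ℕ} (x : ι → Bool) (ψ : QueryBasis ι w → ℂ) :
    ∑ b, ‖queryOp x ψ b‖ ^ 2 = ∑ b, ‖ψ b‖ ^ 2 :=
  Equiv.sum_comp (bitOraclePerm x) fun b => ‖ψ b‖ ^ 2

theorem sum_norm_sq_state (A : QuantumQueryAlgorithm ι) (x : ι → Bool) (t : ℕ) :
    ∑ b, ‖A.state x t b‖ ^ 2 = 1 := by
  induction t with
  | zero =>
    rw [state, Matrix.sum_norm_sq_unitaryGroup_mulVec]
    simp [Pi.single_apply, apply_ite]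
  | succ t ih =>
    rw [state, Matrix.sum_norm_sq_unitaryGroup_mulVec, sum_norm_sq_queryOp, ih]

theorem answerProb_true_add_false (A : QuantumQueryAlgorithm ι) (x : ι → Bool) :
    A.answerProb x true + A.answerProb x false = 1 := by
  rw [← A.sum_norm_sq_state x A.queries, answerProb, answerProb, ← Finset.sum_add_distrib]
  refine Finset.sum_congr rfl fun b _ => ?_
  cases A.output b <;> simp

/-- An algorithm which runs the iteration `ψ ↦ R (bitOracle x ψ)` for a uniform superposition of
`1, …, T` steps and answers `true` when the clock register is back in its uniform state. -/
theorem exists_answerProb_eq_average {κ : Type} [Fintype κ] [DecidableEq κ] {T : ℕ} (hT : 0 < T)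
    (R : Matrix.unitaryGroup (ι × Bool × κ) ℂ) (e : ι × Bool × κ → ℂ) (he : ∑ b, ‖e b‖ ^ 2 = 1) :
    ∃ A : QuantumQueryAlgorithm ι, A.queries = T ∧ ∀ x : ι → Bool, bitOracle x e = e →
      A.answerProb x true = ∑ b, ‖(T : ℂ)⁻¹ * ∑ t ∈ Finset.range T,
        ((fun ψ => (R : Matrix _ _ ℂ) *ᵥ bitOracle x ψ)^[t + 1] e) b‖ ^ 2 := by
  classical
  have hTC : (Real.sqrt T : ℂ) * Real.sqrt T = T := by
    rw [← Complex.ofReal_mul, Real.mul_self_sqrt (by positivity)]; simp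
  have hT0 : (T : ℂ) ≠ 0 := by exact_mod_cast hT.ne'
  have hs0 : (Real.sqrt T : ℂ) ≠ 0 := by
    intro h; rw [h] at hTC; simp at hTC; exact hT0 hTC.symm
  set r : ℂ := (Real.sqrt T : ℂ)⁻¹ with hr
  have hrr : r * r = (T : ℂ)⁻¹ := by rw [hr, ← mul_inv, hTC]
  have hrn : ‖r‖ ^ 2 = (T : ℝ)⁻¹ := by
    rw [hr, norm_inv, Complex.norm_real, Real.norm_of_nonneg (by positivity), inv_pow,
      Real.sq_sqrt (by positivity)]
  let w := Fintype.card (κ × Fin T)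
  let g : κ × Fin T ≃ Fin w := Fintype.equivFin _
  let σ : (ι × Bool × κ) × Fin T ≃ QueryBasis ι w :=
    ((Equiv.prodAssoc _ _ _).trans (Equiv.prodCongr (Equiv.refl _) ((Equiv.prodAssoc _ _ _).trans
      (Equiv.prodCongr (Equiv.refl _) g))))
  have hσ : ∀ i q k t, σ ((i, q, k), t) = (i, q, g (k, t)) := fun _ _ _ _ => rfl
  let t₀ : Fin T := ⟨0, hT⟩
  obtain ⟨F, hF⟩ := Matrix.exists_unitaryGroup_mulVec_single (B := Fin T) (fun _ => r)
    (by simp [hrn, hT.ne']) t₀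
  -- Only this column matters: its conjugate is row `t₀` of `star F`, which reads off the sum over
  -- the clock.
  have hFcol : ∀ t, (F : Matrix (Fin T) (Fin T) ℂ) t t₀ = r := fun t => by
    rw [← congrFun hF t]; simp
  have hstar : (star r) = r := by simp [hr]
  -- The state after `s` queries. The branch with clock value `t` idles during the first `T - 1 - t`
  -- queries, harmlessly since the query fixes `e`; truncated subtraction encodes this. At `s = T`
  -- it has made `t + 1` iterations.
  let pre : ℕ → (ι → Bool) → (ι × Bool × κ) × Fin T → ℂ := fun s x p =>
    r * ((fun ψ => (R : Matrix _ _ ℂ) *ᵥ bitOracle x ψ)^[s - (T - 1 - (p.2 : ℕ))] e) p.1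
  have hne : Nonempty (ι × Bool × κ) := by
    by_contra h
    rw [not_nonempty_iff] at h
    simp at he
  obtain ⟨b₀⟩ := hne
  obtain ⟨M₀, hM₀⟩ := Matrix.exists_unitaryGroup_mulVec_single
    (B := QueryBasis ι w) (fun p => r * e (σ.symm p).1) (by
      rw [← Equiv.sum_comp σ]
      simp only [Equiv.symm_apply_apply, Fintype.sum_prod_type, norm_mul, mul_pow, hrn]
      simp only [Finset.sum_const, Finset.card_univ, Fintype.card_fin, nsmul_eq_mul]
      have : (T : ℝ) ≠ 0 := by exact_mod_cast hT.ne'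
      rw [← he]
      simp only [Fintype.sum_prod_type]
      simp [this]) (σ (b₀, t₀))
  let BD : ℕ → Matrix.unitaryGroup ((ι × Bool × κ) × Fin T) ℂ := fun s =>
    ⟨_, Matrix.blockDiagonal_mem_unitaryGroup (fun t : Fin T => if T ≤ s + t then R else 1)⟩
  let KF : Matrix.unitaryGroup ((ι × Bool × κ) × Fin T) ℂ :=
    ⟨_, Matrix.kronecker_mem_unitary (one_mem (Matrix.unitaryGroup (ι × Bool × κ) ℂ)) (star F).2⟩
  have hKF : KF.1 = Matrix.kroneckerMap (· * ·) (1 : Matrix (ι × Bool × κ) (ι × Bool × κ) ℂ)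
    (star F.1) := rfl
  -- After the last query the clock preparation is undone, so the component at `t₀` becomes the
  -- average, with factor `r * r = T⁻¹`.
  let V : ℕ → Matrix.unitaryGroup ((ι × Bool × κ) × Fin T) ℂ := fun s =>
    if s = T then KF * BD s else BD s
  have hBD : ∀ s x, bitOracle x e = e → 1 ≤ s → s ≤ T →
      (BD s : Matrix ((ι × Bool × κ) × Fin T) ((ι × Bool × κ) × Fin T) ℂ) *ᵥ (fun p => pre (s - 1) x
        ((p.1.1, xor p.1.2.1 (x p.1.1), p.1.2.2), p.2)) = pre s x := by
    intro s x hx h1 hs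
    funext ⟨b, t⟩
    have ht := t.2
    change (Matrix.blockDiagonal _ *ᵥ _) (b, t) = _
    rw [Matrix.blockDiagonal_mulVec_apply]
    change (_ *ᵥ (fun b' => r * bitOracle x ((fun ψ => (R : Matrix _ _ ℂ) *ᵥ
      bitOracle x ψ)^[s - 1 - (T - 1 - (t : ℕ))] e) b')) b = _
    change (_ *ᵥ (r • (bitOracle x ((fun ψ => (R : Matrix _ _ ℂ) *ᵥ
      bitOracle x ψ)^[s - 1 - (T - 1 - (t : ℕ))] e)))) b = _
    rw [Matrix.mulVec_smul]
    by_cases hst : T ≤ s + t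
    · have h3 : s - (T - 1 - (t : ℕ)) = (s - 1 - (T - 1 - (t : ℕ))) + 1 := by omega
      simp only [hst, if_true, pre, h3, Function.iterate_succ_apply']
      rfl
    · have h3 : s - (T - 1 - (t : ℕ)) = 0 := by omega
      have h4 : s - 1 - (T - 1 - (t : ℕ)) = 0 := by omega
      simp only [hst, if_false, pre, h3, h4, Function.iterate_zero, id, hx]
      simp
  let A : QuantumQueryAlgorithm ι :=
    { queries := T
      w := w
      U := fun s => if s = 0 then M₀ else ⟨_, Matrix.reindex_mem_unitaryGroup σ (V s).2⟩
      start := σ (b₀, t₀)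
      output := fun p => decide ((σ.symm p).2 = t₀) }
  have hstate : ∀ x, bitOracle x e = e → ∀ s < T, ∀ p, A.state x s (σ p) = pre s x p := by
    intro x hx s
    induction s with
    | zero =>
      intro _ p
      change ((M₀ : Matrix _ _ ℂ) *ᵥ Pi.single (σ (b₀, t₀)) 1) (σ p) = _
      rw [hM₀]
      simp [pre]
    | succ s ih =>
      intro hs p
      change ((Matrix.reindex σ σ (V (s + 1) : Matrix _ _ ℂ)) *ᵥ queryOp x (A.state x s)) (σ p) = _
      rw [Matrix.reindex_mulVec_apply]
      simp only [V, hs.ne, if_false]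
      rw [← hBD (s + 1) x hx (by omega) hs.le]
      refine congrArg (fun v => Matrix.mulVec (BD (s + 1)).1 v p) (funext fun p' => ?_)
      exact ih (by omega) ((p'.1.1, xor p'.1.2.1 (x p'.1.1), p'.1.2.2), p'.2)
  refine ⟨A, rfl, fun x hx => ?_⟩
  have hfin : ∀ b, A.state x T (σ (b, t₀)) = (T : ℂ)⁻¹ * ∑ t ∈ Finset.range T,
      ((fun ψ => (R : Matrix _ _ ℂ) *ᵥ bitOracle x ψ)^[t + 1] e) b := by
    intro b
    obtain ⟨s, rfl⟩ : ∃ s, T = s + 1 := ⟨T - 1, by omega⟩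
    change ((Matrix.reindex σ σ (V (s + 1) : Matrix _ _ ℂ)) *ᵥ queryOp x (A.state x s))
      (σ (b, t₀)) = _
    rw [Matrix.reindex_mulVec_apply]
    simp only [V, if_true, Matrix.UnitaryGroup.mul_val]
    rw [← Matrix.mulVec_mulVec]
    have h1 : (BD (s + 1) : Matrix _ _ ℂ) *ᵥ (queryOp x (A.state x s) ∘ σ) = pre (s + 1) x := by
      rw [← hBD (s + 1) x hx (by omega) le_rfl]
      refine congrArg _ (funext fun p' => ?_)
      exact hstate x hx s (by omega) ((p'.1.1, xor p'.1.2.1 (x p'.1.1), p'.1.2.2), p'.2)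
    rw [h1]
    rw [hKF, Matrix.one_kronecker_mulVec_apply, Finset.sum_range, Finset.mul_sum]
    refine Finset.sum_congr rfl fun t _ => ?_
    rw [Matrix.star_apply, hFcol, hstar]
    have h3 : s + 1 - (s + 1 - 1 - (t : ℕ)) = t + 1 := by have := t.2; omega
    simp only [pre, h3]
    rw [← mul_assoc, hrr]
  rw [answerProb]
  change ∑ p : QueryBasis ι w, (if decide ((σ.symm p).2 = t₀) = true then
    ‖A.state x T p‖ ^ 2 else 0) = _
  rw [← Equiv.sum_comp σ, Fintype.sum_prod_type]
  refine Finset.sum_congr rfl fun b _ => ?_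
  rw [Finset.sum_eq_single t₀]
  · simp [hfin]
  · intro t _ ht; simp [ht]
  · simp

end QuantumQueryAlgorithm

/-! ### Dual adversary solutions and their composition along decision trees -/

/-- A feasible solution of the dual adversary semidefinite program with objective value at most `c`
for the problem of deciding `f` on the inputs `o x`, `x ∈ D`. -/
def DualAdversary {X ι : Type} [Fintype ι] (o : X → ι → Bool) (f : X → Prop) (D : Set X)
    (c : ℝ) : Prop :=
  ∃ (J : Type) (_ : Fintype J) (u : X → ι → J → ℝ),
    (∀ x ∈ D, ∑ i, ∑ j, u x i j ^ 2 ≤ c) ∧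
    ∀ x ∈ D, ∀ y ∈ D, f x → ¬ f y →
      ∑ i, ∑ j, (if o x i = o y i then 0 else u x i j * u y i j) = 1

namespace DualAdversary

variable {X ι : Type} [Fintype ι] {o : X → ι → Bool} {f : X → Prop} {D : Set X} {c : ℝ}

theorem mono (h : DualAdversary o f D c) {c' : ℝ} (hc : c ≤ c') : DualAdversary o f D c' := by
  obtain ⟨J, _, u, h1, h2⟩ := h
  exact ⟨J, _, u, fun x hx => (h1 x hx).trans hc, h2⟩

/-- A leaf of the decision tree: no two inputs have to be separated, so there are no constraints and
zero vectors suffice. -/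
theorem of_const (hc : 0 ≤ c) (p : Prop) (h : ∀ x ∈ D, (f x ↔ p)) : DualAdversary o f D c := by
  refine ⟨Empty, inferInstance, fun _ _ _ => 0, fun x _ => by simpa using hc, ?_⟩
  intro x hx y hy hfx hfy
  exact (hfy ((h y hy).2 ((h x hx).1 hfx))).elim

/-- Querying `o x i`, where the answer `false` costs `g` and the answer `true` costs `g⁻¹`. -/
theorem query [DecidableEq ι] (i : ι) {g c₀ c₁ : ℝ} (hg : 0 < g)
    (h₀ : DualAdversary o f {x ∈ D | o x i = false} c₀)
    (h₁ : DualAdversary o f {x ∈ D | o x i = true} c₁)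
    (hc₀ : c₀ + g ≤ c) (hc₁ : c₁ + g⁻¹ ≤ c) : DualAdversary o f D c := by
  obtain ⟨J₀, _, u₀, h₀, h₀'⟩ := h₀
  obtain ⟨J₁, _, u₁, h₁, h₁'⟩ := h₁
  have hs : Real.sqrt g ^ 2 = g := Real.sq_sqrt hg.le
  have hs0 : Real.sqrt g ≠ 0 := (Real.sqrt_pos.2 hg).ne'
  -- The `Unit` coordinate handles the root: for different answers the product is `√g * (√g)⁻¹ = 1`,
  -- and the squares are the costs `g` and `g⁻¹`. The other coordinates vanish off their branch, so
  -- they contribute only when both inputs follow the same branch.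
  refine ⟨Unit ⊕ J₀ ⊕ J₁, inferInstance, fun x i' j => match j with
    | .inl _ => if i' = i then (if o x i = true then (Real.sqrt g)⁻¹ else Real.sqrt g) else 0
    | .inr (.inl j) => if o x i = false then u₀ x i' j else 0
    | .inr (.inr j) => if o x i = true then u₁ x i' j else 0, ?_, ?_⟩
  · intro x hx
    simp only [Fintype.sum_sum_type, Finset.univ_unique, Finset.sum_singleton,
      Finset.sum_add_distrib, ite_pow, ne_eq, OfNat.ofNat_ne_zero, not_false_eq_true, zero_pow,
      Finset.sum_ite_eq', Finset.mem_univ, if_true]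
    cases h : o x i
    · have := h₀ x ⟨hx, h⟩
      simp [hs]
      linarith
    · have := h₁ x ⟨hx, h⟩
      simp [hs]
      linarith
  · intro x hx y hy hfx hfy
    simp only [Fintype.sum_sum_type, Finset.univ_unique, Finset.sum_singleton,
      Finset.sum_add_distrib]
    have hroot : ∀ a b : ℝ, (∑ i', if o x i' = o y i' then (0 : ℝ) else
        (if i' = i then a else 0) * (if i' = i then b else 0)) =
        if o x i = o y i then 0 else a * b := by
      intro a b
      rw [Finset.sum_eq_single i] <;> simp +contextual
    rw [hroot]
    cases h : o x i <;> cases h' : o y i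
    · have := h₀' x ⟨hx, h⟩ y ⟨hy, h'⟩ hfx hfy
      simpa using this
    · simp [hs0]
    · simp [hs0]
    · have := h₁' x ⟨hx, h⟩ y ⟨hy, h'⟩ hfx hfy
      simpa using this

end DualAdversary

/-! ### Averages of the iterates of an isometry -/

section average

variable {E : Type*} [NormedAddCommGroup E] [InnerProductSpace ℂ E]

/-- Since `φ` is invariant, every iterate of `e`, hence their average, has inner product `1` with
`φ`; Cauchy–Schwarz finishes. -/
theorem LinearIsometryEquiv.two_thirds_le_norm_sq_average (U : E ≃ₗᵢ[ℂ] E) {T : ℕ} (hT : 0 < T)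
    {φ e : E} (hφ : U φ = φ) (hφe : inner ℂ φ e = 1) (hn : ‖φ‖ ^ 2 ≤ 3 / 2) :
    2 / 3 ≤ ‖(T : ℂ)⁻¹ • ∑ t ∈ Finset.range T, U^[t + 1] e‖ ^ 2 := by
  have h1 : ∀ t : ℕ, inner ℂ φ (U^[t] e) = 1 := by
    intro t
    induction t with
    | zero => simpa using hφe
    | succ t ih =>
      rw [Function.iterate_succ_apply', ← ih]
      conv_lhs => rw [← hφ]
      exact U.inner_map_map _ _
  have hT0 : (T : ℂ) ≠ 0 := by exact_mod_cast hT.ne'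
  have h2 : inner ℂ φ ((T : ℂ)⁻¹ • ∑ t ∈ Finset.range T, U^[t + 1] e) = 1 := by
    rw [inner_smul_right, inner_sum]
    simp only [h1]
    simp [hT0]
  have h3 := norm_inner_le_norm (𝕜 := ℂ) φ ((T : ℂ)⁻¹ • ∑ t ∈ Finset.range T, U^[t + 1] e)
  rw [h2, norm_one] at h3
  set a := ‖(T : ℂ)⁻¹ • ∑ t ∈ Finset.range T, U^[t + 1] e‖
  have h4 : 1 ≤ ‖φ‖ ^ 2 * a ^ 2 := by nlinarith
  nlinarith [sq_nonneg a]

/-- The relation for `w` makes twice the sum of the iterates telescope to `U^[T] w - w`, so the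
average has norm at most `‖w‖ / T`. This elementary estimate takes the place of the effective
spectral gap lemma. -/
theorem LinearIsometryEquiv.norm_sq_average_le (U : E ≃ₗᵢ[ℂ] E) {T : ℕ} (hT : 0 < T)
    {w e : E} (hw : U w = w + (2 : ℂ) • U e) (hn : 3 * ‖w‖ ^ 2 ≤ T ^ 2) :
    ‖(T : ℂ)⁻¹ • ∑ t ∈ Finset.range T, U^[t + 1] e‖ ^ 2 ≤ 1 / 3 := by
  have hnorm : ∀ t : ℕ, ‖U^[t] w‖ = ‖w‖ := by
    intro t
    induction t with
    | zero => rfl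
    | succ t ih => rw [Function.iterate_succ_apply', U.norm_map, ih]
  have h0 : ∀ t : ℕ, U^[t + 1] w = U^[t] w + (2 : ℂ) • U^[t + 1] e := by
    intro t
    induction t with
    | zero => simpa using hw
    | succ t ih =>
      have h := congrArg U ih
      rw [map_add, map_smul] at h
      simp only [Function.iterate_succ_apply'] at h ⊢
      exact h
  have h1 : ∀ t : ℕ, (2 : ℂ) • ∑ s ∈ Finset.range t, U^[s + 1] e = U^[t] w - w := by
    intro t
    induction t with
    | zero => simp
    | succ t ih => rw [Finset.sum_range_succ, smul_add, ih, h0]; abel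
  have h2 : 2 * ‖∑ s ∈ Finset.range T, U^[s + 1] e‖ ≤ 2 * ‖w‖ := by
    have := congrArg norm (h1 T)
    rw [norm_smul, Complex.norm_two] at this
    have h3 := norm_sub_le (U^[T] w) w
    rw [hnorm] at h3
    linarith
  have hT' : (0 : ℝ) < T := by exact_mod_cast hT
  rw [norm_smul, norm_inv, Complex.norm_natCast, mul_pow, inv_pow, inv_mul_le_iff₀ (by positivity)]
  have := norm_nonneg (∑ s ∈ Finset.range T, U^[s + 1] e)
  nlinarith

end average

/-! ### Witness vectors of the walk and the action of a query on them -/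

section walk

variable {ι J : Type} [Fintype ι] [DecidableEq ι] [Fintype J]

/-- The (real) amplitudes of `walkVec`. -/
noncomputable def walkAmp (i₀ : ι) (s : ℝ) (c : ι → Bool) (a : ι → J → ℝ) :
    ι × Bool × Option (J × Bool) → ℝ
  | (i, _, none) => if i = i₀ then (Real.sqrt 2)⁻¹ else 0
  | (i, q, some (j, b)) =>
    if b = c i then (if q then -1 else 1) * (s * a i j * (Real.sqrt 2)⁻¹) else 0

/-- The vector `|i₀⟩|+⟩|none⟩ + s ∑ᵢⱼ aᵢⱼ |i⟩|-⟩|j, cᵢ⟩`. -/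
noncomputable def walkVec (i₀ : ι) (s : ℝ) (c : ι → Bool) (a : ι → J → ℝ) :
    EuclideanSpace ℂ (ι × Bool × Option (J × Bool)) :=
  WithLp.toLp 2 fun p => (walkAmp i₀ s c a p : ℂ)

/-- Different flags give orthogonal basis states. Taking `c = x` and `c' = ¬ y`, only the indices
where `x` and `y` differ survive, which is the sum in the dual adversary constraint. -/
theorem inner_walkVec (i₀ : ι) (s s' : ℝ) (c c' : ι → Bool) (a a' : ι → J → ℝ) :
    inner ℂ (walkVec i₀ s c a) (walkVec i₀ s' c' a') =
      ((1 + s * s' * ∑ i, ∑ j, (if c i = c' i then a i j * a' i j else 0) : ℝ) : ℂ) := by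
  have h2 : (Real.sqrt 2)⁻¹ * (Real.sqrt 2)⁻¹ = 1 / 2 := by
    rw [← mul_inv, Real.mul_self_sqrt (by norm_num)]; norm_num
  have h : inner ℂ (walkVec i₀ s c a) (walkVec i₀ s' c' a') =
      ((∑ p, walkAmp i₀ s c a p * walkAmp i₀ s' c' a' p : ℝ) : ℂ) := by
    simp only [PiLp.inner_apply, walkVec, RCLike.inner_apply, Complex.conj_ofReal]
    push_cast
    exact Finset.sum_congr rfl fun p _ => mul_comm _ _
  rw [h]
  congr 1
  simp only [Fintype.sum_prod_type, Fintype.sum_bool, Fintype.sum_option, walkAmp]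
  have h3 : ∀ i : ι, ((if i = i₀ then (Real.sqrt 2)⁻¹ else 0) *
      (if i = i₀ then (Real.sqrt 2)⁻¹ else 0) : ℝ) = if i = i₀ then 1 / 2 else 0 := by
    intro i; split_ifs <;> simp [h2]
  have h4 : ∀ (i : ι) (j : J) (r : ℝ), r * r = 1 →
      ((if true = c i then r * (s * a i j * (Real.sqrt 2)⁻¹) else 0) *
        (if true = c' i then r * (s' * a' i j * (Real.sqrt 2)⁻¹) else 0) +
      (if false = c i then r * (s * a i j * (Real.sqrt 2)⁻¹) else 0) *
        (if false = c' i then r * (s' * a' i j * (Real.sqrt 2)⁻¹) else 0)) =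
      1 / 2 * (s * s' * (if c i = c' i then a i j * a' i j else 0)) := by
    intro i j r hr
    have : r * (s * a i j * (Real.sqrt 2)⁻¹) * (r * (s' * a' i j * (Real.sqrt 2)⁻¹)) =
      1 / 2 * (s * s' * (a i j * a' i j)) := by
      rw [← h2]; linear_combination (s * a i j * (Real.sqrt 2)⁻¹ * (s' * a' i j * (Real.sqrt 2)⁻¹)) * hr
    cases c i <;> cases c' i <;> simp [this]
  simp only [h3, if_true, Bool.false_eq_true, if_false]
  simp only [h4 _ _ (-1) (by norm_num), h4 _ _ 1 (by norm_num)]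
  simp only [Finset.sum_add_distrib, Finset.sum_ite_eq', Finset.mem_univ, if_true,
    ← Finset.mul_sum]
  ring

theorem norm_sq_walkVec (i₀ : ι) (s : ℝ) (c : ι → Bool) (a : ι → J → ℝ) :
    ‖walkVec i₀ s c a‖ ^ 2 = 1 + s ^ 2 * ∑ i, ∑ j, a i j ^ 2 := by
  have h := inner_self_eq_norm_sq_to_K (𝕜 := ℂ) (walkVec i₀ s c a)
  rw [inner_walkVec] at h
  have h' : (1 + s * s * ∑ i, ∑ j, (if c i = c i then a i j * a i j else 0)) =
    ‖walkVec i₀ s c a‖ ^ 2 :=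
    Complex.ofReal_injective (h.trans (by push_cast; rfl))
  rw [← h']
  simp [sq]

omit [Fintype ι] [Fintype J] in
theorem walkVec_add_neg (i₀ : ι) (s : ℝ) (c : ι → Bool) (a : ι → J → ℝ) :
    walkVec i₀ (-s) c a = (2 : ℂ) • walkVec i₀ 0 c a - walkVec i₀ s c a := by
  ext ⟨i, q, k⟩
  rcases k with _ | ⟨j, b⟩
  · simp [walkVec, walkAmp]; ring
  · by_cases h : b = c i <;> simp [walkVec, walkAmp, h]

omit [Fintype ι] [Fintype J] in
theorem walkVec_zero (i₀ : ι) (c c' : ι → Bool) (a a' : ι → J → ℝ) :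
    walkVec i₀ 0 c a = walkVec i₀ 0 c' a' := by
  ext ⟨i, q, k⟩
  rcases k with _ | ⟨j, b⟩ <;> simp [walkVec, walkAmp]

/-- The sign attached to a workspace basis state. -/
def walkSign : Option (J × Bool) → ℂ
  | some (_, true) => -1
  | _ => 1

/-- The diagonal operator with entries `walkSign`. -/
noncomputable def walkFlip : EuclideanSpace ℂ (ι × Bool × Option (J × Bool)) ≃ₗᵢ[ℂ]
    EuclideanSpace ℂ (ι × Bool × Option (J × Bool)) :=
  LinearIsometryEquiv.piLpCongrRight 2 fun p => match p with
    | (_, _, some (_, true)) => LinearIsometryEquiv.neg ℂ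
    | (_, _, _) => LinearIsometryEquiv.refl ℂ ℂ

omit [DecidableEq ι] in
theorem walkFlip_apply (v : EuclideanSpace ℂ (ι × Bool × Option (J × Bool)))
    (p : ι × Bool × Option (J × Bool)) : walkFlip v p = walkSign p.2.2 * v p := by
  obtain ⟨i, q, _ | ⟨j, _ | _⟩⟩ := p <;> simp [walkFlip, walkSign]

/-- The query operator followed by `walkFlip`. -/
noncomputable def walkQuery (x : ι → Bool) : EuclideanSpace ℂ (ι × Bool × Option (J × Bool)) ≃ₗᵢ[ℂ]
    EuclideanSpace ℂ (ι × Bool × Option (J × Bool)) :=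
  (LinearIsometryEquiv.piLpCongrLeft 2 ℂ ℂ (bitOraclePerm x)).trans walkFlip

omit [DecidableEq ι] in
theorem walkQuery_apply (x : ι → Bool) (v : EuclideanSpace ℂ (ι × Bool × Option (J × Bool)))
    (p : ι × Bool × Option (J × Bool)) :
    walkQuery x v p = walkSign p.2.2 * bitOracle x (WithLp.ofLp v) p := by
  rw [walkQuery, LinearIsometryEquiv.trans_apply, walkFlip_apply]
  rfl

/-- Phase kickback: on target `|-⟩` the query gives the sign `(-1)^(x i)` and `walkFlip` gives
`(-1)^b`. They cancel when the flag is `b = x i`; the part with target `|+⟩` is fixed anyway. -/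
theorem walkQuery_walkVec (x : ι → Bool) (i₀ : ι) (s : ℝ) (a : ι → J → ℝ) :
    walkQuery x (walkVec i₀ s x a) = walkVec i₀ s x a := by
  ext ⟨i, q, k⟩
  rw [walkQuery_apply]
  rcases k with _ | ⟨j, b⟩
  · simp [walkVec, walkAmp, walkSign, bitOracle]
  · by_cases h : b = x i
    · subst h
      cases hx : x i <;> cases q <;> simp [walkVec, walkAmp, walkSign, bitOracle, hx]
    · simp [walkVec, walkAmp, bitOracle, h]

/-- With the opposite flag the two signs of the phase kickback multiply to `-1`. -/
theorem walkQuery_walkVec_not (x : ι → Bool) (i₀ : ι) (s : ℝ) (a : ι → J → ℝ) :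
    walkQuery x (walkVec i₀ s (fun i => !x i) a) = walkVec i₀ (-s) (fun i => !x i) a := by
  ext ⟨i, q, k⟩
  rw [walkQuery_apply]
  rcases k with _ | ⟨j, b⟩
  · simp [walkVec, walkAmp, walkSign, bitOracle]
  · by_cases h : b = !x i
    · subst h
      cases hx : x i <;> cases q <;> simp [walkVec, walkAmp, walkSign, bitOracle, hx]
    · simp [walkVec, walkAmp, bitOracle, h]

end walk

open Classical in
/-- A feasible solution of the dual adversary program gives a bounded-error quantum algorithm. -/
theorem DualAdversary.exists_algorithm {X ι : Type} [Fintype ι] [DecidableEq ι] [Nonempty ι]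
    {o : X → ι → Bool} {f : X → Prop} {W : ℝ} (hW : 1 ≤ W)
    (h : DualAdversary o f Set.univ W) {T : ℕ} (hT : 3 * W ≤ T) :
    ∃ A : QuantumQueryAlgorithm ι, A.queries = T ∧
      ∀ x, 2 / 3 ≤ A.answerProb (o x) (decide (f x)) := by
  obtain ⟨J, _, u, hu, huv⟩ := h
  have hT0 : 0 < T := by
    have : (0 : ℝ) < T := by linarith
    exact_mod_cast this
  obtain ⟨i₀⟩ := ‹Nonempty ι›
  -- The weights `-ε` and `√(2W)` multiply to `-1`, which makes positive and negative witnesses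
  -- orthogonal; `ε² = 1 / (2W)` gives `‖pos x‖² ≤ 3/2`.
  set ε : ℝ := (Real.sqrt (2 * W))⁻¹ with hε
  have hsq : Real.sqrt (2 * W) ^ 2 = 2 * W := Real.sq_sqrt (by linarith)
  have hs0 : Real.sqrt (2 * W) ≠ 0 := (Real.sqrt_pos.2 (by linarith)).ne'
  let e : EuclideanSpace ℂ (ι × Bool × Option (J × Bool)) := walkVec i₀ 0 (fun _ => true) 0
  let pos : X → EuclideanSpace ℂ (ι × Bool × Option (J × Bool)) :=
    fun x => walkVec i₀ (-ε) (o x) (u x)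
  let neg : X → EuclideanSpace ℂ (ι × Bool × Option (J × Bool)) :=
    fun y => walkVec i₀ (Real.sqrt (2 * W)) (fun i => !o y i) (u y)
  let K : Submodule ℂ (EuclideanSpace ℂ (ι × Bool × Option (J × Bool))) :=
    Submodule.span ℂ (neg '' {y | ¬ f y})
  -- `R` negates all negative witnesses and, by orthogonality, fixes all positive ones. It depends
  -- on `f` but not on the input.
  let R := Kᗮ.reflection
  have hRpos : ∀ x, f x → R (pos x) = pos x := by
    intro x hx
    refine Submodule.reflection_mem_subspace_eq_self ?_
    rw [Submodule.mem_orthogonal]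
    intro v hv
    induction hv using Submodule.span_induction with
    | mem v hv =>
      obtain ⟨y, hy, rfl⟩ := hv
      rw [inner_walkVec]
      have h1 := huv x trivial y trivial hx hy
      have h2 : ∑ i, ∑ j, (if (!o y i) = o x i then u y i j * u x i j else 0) = 1 := by
        rw [← h1]
        refine Finset.sum_congr rfl fun i _ => Finset.sum_congr rfl fun j _ => ?_
        cases o x i <;> cases o y i <;> simp [mul_comm]
      have h3 : 1 + Real.sqrt (2 * W) * -ε * 1 = 0 := by rw [hε]; field_simp; ring
      rw [h2, h3, Complex.ofReal_zero]
    | zero => simp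
    | add v w _ _ hv hw => rw [inner_add_left, hv, hw, add_zero]
    | smul c v _ hv => rw [inner_smul_left, hv, mul_zero]
  have hRneg : ∀ y, ¬ f y → R (neg y) = - neg y := by
    intro y hy
    rw [Submodule.reflection_orthogonal_apply, Submodule.reflection_mem_subspace_eq_self]
    exact Submodule.subset_span ⟨y, hy, rfl⟩
  obtain ⟨M, hM⟩ := (walkFlip.trans R).exists_unitaryGroup_mulVec
  have hstep : ∀ (x : ι → Bool) (v : EuclideanSpace ℂ (ι × Bool × Option (J × Bool))),
      (M : Matrix _ _ ℂ) *ᵥ bitOracle x (WithLp.ofLp v) =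
        WithLp.ofLp (((walkQuery x).trans R) v) := by
    intro x v
    rw [hM]
    rfl
  have hiter : ∀ (x : ι → Bool) (t : ℕ),
      (fun ψ => (M : Matrix _ _ ℂ) *ᵥ bitOracle x ψ)^[t] (WithLp.ofLp e) =
        WithLp.ofLp (((walkQuery x).trans R)^[t] e) := by
    intro x t
    induction t with
    | zero => rfl
    | succ t ih => rw [Function.iterate_succ_apply', Function.iterate_succ_apply', ih, hstep]
  have hnorm : ∑ b, ‖e b‖ ^ 2 = 1 := by
    rw [← EuclideanSpace.norm_sq_eq, norm_sq_walkVec]; simp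
  have hfix : ∀ x : ι → Bool, bitOracle x (WithLp.ofLp e) = WithLp.ofLp e := by
    intro x
    funext ⟨i, q, k⟩
    rcases k with _ | ⟨j, b⟩ <;> simp [e, walkVec, walkAmp, bitOracle]
  obtain ⟨A, hA, hprob⟩ := QuantumQueryAlgorithm.exists_answerProb_eq_average hT0 M
    (WithLp.ofLp e) hnorm
  have hprob' : ∀ x : ι → Bool, A.answerProb x true =
      ‖(T : ℂ)⁻¹ • ∑ t ∈ Finset.range T, ((walkQuery x).trans R)^[t + 1] e‖ ^ 2 := by
    intro x
    rw [hprob x (hfix x), EuclideanSpace.norm_sq_eq]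
    refine Finset.sum_congr rfl fun b _ => ?_
    simp only [hiter, PiLp.smul_apply, smul_eq_mul, WithLp.ofLp_sum, Finset.sum_apply]
  refine ⟨A, hA, fun x => ?_⟩
  have hux := hu x trivial
  by_cases hfx : f x
  · rw [decide_eq_true hfx, hprob']
    refine LinearIsometryEquiv.two_thirds_le_norm_sq_average _ hT0 (φ := pos x) ?_ ?_ ?_
    · rw [LinearIsometryEquiv.trans_apply, walkQuery_walkVec, hRpos x hfx]
    · rw [inner_walkVec]; simp
    · rw [norm_sq_walkVec, neg_sq, hε, inv_pow, hsq]
      have : (2 * W)⁻¹ * ∑ i, ∑ j, u x i j ^ 2 ≤ 1 / 2 := by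
        rw [inv_mul_le_iff₀ (by linarith)]; linarith
      linarith
  · rw [decide_eq_false hfx]
    have hsum := A.answerProb_true_add_false (o x)
    rw [hprob' (o x)] at hsum
    -- The query sends `neg x` to `2 e - neg x`, and then `R` gives `neg x + 2 R e`; as the query
    -- fixes `e`, the last term is `2 U e`. The norm condition is `3 (1 + 2 W²) ≤ 9 W² ≤ T²`.
    have := LinearIsometryEquiv.norm_sq_average_le ((walkQuery (o x)).trans R) hT0
      (w := neg x) (e := e) ?_ ?_
    · linarith
    · have he : e = walkVec i₀ 0 (fun i => !o x i) (u x) := walkVec_zero _ _ _ _ _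
      have h0 : walkQuery (o x) e = e := by
        rw [he]
        have := walkQuery_walkVec_not (o x) i₀ 0 (u x)
        simpa using this
      rw [LinearIsometryEquiv.trans_apply, LinearIsometryEquiv.trans_apply,
        walkQuery_walkVec_not, walkVec_add_neg, h0, ← he, map_sub, map_smul, hRneg x hfx]
      abel
    · rw [norm_sq_walkVec, hsq]
      have h1 : 2 * W * ∑ i, ∑ j, u x i j ^ 2 ≤ 2 * W * W :=
        mul_le_mul_of_nonneg_left hux (by linarith)
      nlinarith

/-! ### Upper bound: the decision tree for vertex cover -/

theorem adjOracle_mk_eq_true {n : ℕ} (G : SimpleGraph (Fin n)) {v w : Fin n}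
    (h : ¬ (s(v, w)).IsDiag) : adjOracle G ⟨s(v, w), h⟩ = true ↔ G.Adj v w := by
  simp [adjOracle]

theorem adjOracle_mk_eq_false {n : ℕ} (G : SimpleGraph (Fin n)) {v w : Fin n}
    (h : ¬ (s(v, w)).IsDiag) : adjOracle G ⟨s(v, w), h⟩ = false ↔ ¬ G.Adj v w := by
  simp [adjOracle]

/-- Learning up to `k + 1` neighbours of each vertex of the vertex cover `V` decides whether there
is a vertex cover of size at most `k`. -/
theorem dualAdversary_of_cover {n k : ℕ} {g : ℝ} (hg : 0 < g) (V : Finset (Fin n))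
    (L : List (Fin n × Fin n)) (F : Finset (Fin n × Fin n)) (D : Set (SimpleGraph (Fin n)))
    (hFV : ∀ p ∈ F, p.1 ∈ V) (hLV : ∀ p ∈ L, p.1 ∈ V)
    (hdeg : ∀ v, (F.filter (fun p => p.1 = v)).card ≤ k + 1)
    (hF : ∀ G ∈ D, ∀ p ∈ F, G.Adj p.1 p.2)
    (hV : ∀ G ∈ D, ∀ v w, G.Adj v w → v ∈ V ∨ w ∈ V)
    (hscan : ∀ G ∈ D, ∀ v ∈ V, ∀ w, G.Adj v w →
      (v, w) ∈ L ∨ (v, w) ∈ F ∨ k + 1 ≤ (F.filter (fun p => p.1 = v)).card) :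
    DualAdversary adjOracle (HasVertexCoverLE k) D
      (L.length * g + (V.card * (k + 1) - F.card) * g⁻¹) := by
  have hgi : 0 < g⁻¹ := inv_pos.2 hg
  -- `L` holds the pairs still to be scanned and `F` the edges found. A zero shortens `L`; a one
  -- enlarges `F`, whose size is at most `V.card * (k + 1)`.
  induction L generalizing F D with
  | nil =>
    have hcard : F.card ≤ V.card * (k + 1) := by
      rw [Finset.card_eq_sum_card_fiberwise (f := Prod.fst) (t := V) hFV]
      exact (Finset.sum_le_sum fun v _ => hdeg v).trans (by simp)
    have hcard' : (F.card : ℝ) ≤ V.card * (k + 1) := by exact_mod_cast hcard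
    refine DualAdversary.of_const ?_
      (∃ S : Finset (Fin n), S.card ≤ k ∧ ∀ p ∈ F, p.1 ∈ S ∨ p.2 ∈ S) fun G hG => ?_
    · have := mul_nonneg (sub_nonneg.2 hcard') hgi.le
      simpa using this
    constructor
    · rintro ⟨S, hS, hc⟩
      exact ⟨S, hS, fun p hp => hc (hF G hG p hp)⟩
    · rintro ⟨S, hS, hc⟩
      refine ⟨S, hS, ?_⟩
      have key : ∀ v w, v ∈ V → G.Adj v w → v ∈ S ∨ w ∈ S := by
        intro v w hv hvw
        rcases hscan G hG v hv w hvw with h | h | h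
        · simp at h
        · exact hc _ h
        -- A small cover avoiding `v` would have to contain all `k + 1` known neighbours of `v`.
        · left
          by_contra hvS
          have hinj : (F.filter (fun p => p.1 = v)).card ≤ S.card := by
            refine Finset.card_le_card_of_injOn Prod.snd (fun p hp => ?_) fun p hp q hq hpq => ?_
            · obtain ⟨hpF, hpv⟩ := Finset.mem_filter.1 hp
              rcases hc p hpF with h' | h'
              · rw [hpv] at h'; exact (hvS h').elim
              · exact h'
            · exact Prod.ext ((Finset.mem_filter.1 hp).2.trans (Finset.mem_filter.1 hq).2.symm) hpq
          omega
      intro v w hvw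
      rcases hV G hG v w hvw with h | h
      · exact key v w h hvw
      · exact (key w v h hvw.symm).symm
  | cons p L ih =>
    obtain ⟨v, w⟩ := p
    have hLV' : ∀ p ∈ L, p.1 ∈ V := fun p hp => hLV p (List.mem_cons_of_mem _ hp)
    have hv : v ∈ V := hLV (v, w) List.mem_cons_self
    simp only [List.length_cons, Nat.cast_add, Nat.cast_one]
    by_cases hskip : v = w ∨ (v, w) ∈ F ∨ k + 1 ≤ (F.filter (fun p => p.1 = v)).card
    · refine (ih F D hFV hLV' hdeg hF hV fun G hG a ha b hab => ?_).mono (by linarith)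
      rcases hscan G hG a ha b hab with h | h | h
      · rcases List.mem_cons.1 h with h | h
        · obtain ⟨rfl, rfl⟩ := Prod.mk.inj h
          rcases hskip with h | h
          · exact (G.ne_of_adj hab h).elim
          · exact Or.inr h
        · exact Or.inl h
      · exact Or.inr (Or.inl h)
      · exact Or.inr (Or.inr h)
    · push Not at hskip
      obtain ⟨hne, hvF, hlt⟩ := hskip
      have hd : ¬ (s(v, w)).IsDiag := by simpa using hne
      refine DualAdversary.query ⟨s(v, w), hd⟩ hg
        (ih F _ hFV hLV' hdeg (fun G hG => hF G hG.1) (fun G hG => hV G hG.1) ?_)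
        (ih (insert (v, w) F) _ ?_ hLV' ?_ ?_ (fun G hG => hV G hG.1) ?_) (by linarith) ?_
      · rintro G ⟨hG, hq⟩ a ha b hab
        rw [adjOracle_mk_eq_false] at hq
        rcases hscan G hG a ha b hab with h | h
        · rcases List.mem_cons.1 h with h | h
          · obtain ⟨rfl, rfl⟩ := Prod.mk.inj h
            exact (hq hab).elim
          · exact Or.inl h
        · exact Or.inr h
      · intro p hp
        rcases Finset.mem_insert.1 hp with rfl | hp
        · exact hv
        · exact hFV p hp
      · intro a
        rw [Finset.filter_insert]
        split_ifs with h
        · have h' : v = a := h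
          subst h'
          rw [Finset.card_insert_of_notMem (by simp [hvF])]
          omega
        · exact hdeg a
      · rintro G ⟨hG, hq⟩ p hp
        rw [adjOracle_mk_eq_true] at hq
        rcases Finset.mem_insert.1 hp with rfl | hp
        · exact hq
        · exact hF G hG p hp
      · rintro G ⟨hG, hq⟩ a ha b hab
        rcases hscan G hG a ha b hab with h | h | h
        · rcases List.mem_cons.1 h with h | h
          · exact Or.inr (Or.inl (by rw [h]; exact Finset.mem_insert_self _ _))
          · exact Or.inl h
        · exact Or.inr (Or.inl (Finset.mem_insert_of_mem h))
        · refine Or.inr (Or.inr (h.trans (Finset.card_le_card ?_)))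
          exact Finset.filter_subset_filter _ (Finset.subset_insert _ _)
      · rw [Finset.card_insert_of_notMem hvF]
        push_cast
        nlinarith

/-- Learning a greedy maximal matching on the vertex set `V` first. -/
theorem dualAdversary_of_matching {n k : ℕ} {g g' : ℝ} (hg : 0 < g) (hg' : 0 < g')
    (L : List (Fin n × Fin n)) (V : Finset (Fin n)) (m : ℕ) (D : Set (SimpleGraph (Fin n)))
    (hm : m ≤ k + 1) (hVm : V.card ≤ 2 * m)
    (hcov : ∀ G ∈ D, ∀ S : Finset (Fin n), G.IsVertexCover (S : Set (Fin n)) → m ≤ (S ∩ V).card)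
    (hscan : ∀ G ∈ D, ∀ v w, G.Adj v w → v ∈ V ∨ w ∈ V ∨ (v, w) ∈ L) :
    DualAdversary adjOracle (HasVertexCoverLE k) D
      (L.length * g + (k + 1 - m) * g⁻¹ + (2 * k * n * g' + 2 * k * (k + 1) * g'⁻¹)) := by
  have hgi : 0 < g⁻¹ := inv_pos.2 hg
  have hgi' : 0 < g'⁻¹ := inv_pos.2 hg'
  have hbase : 0 ≤ 2 * k * n * g' + 2 * k * (k + 1) * g'⁻¹ := by positivity
  -- Here `m` is the size of the matching found and `V` its vertex set; at `k + 1` edges the answer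
  -- is negative. The matching itself is not stored: `hcov` keeps its only needed consequence.
  by_cases hmk : m = k + 1
  · refine DualAdversary.of_const ?_ False fun G hG => ?_
    · subst hmk
      have : (0 : ℝ) ≤ L.length * g := by positivity
      push_cast
      rw [sub_self, zero_mul]
      linarith
    · rw [iff_false]
      rintro ⟨S, hS, hc⟩
      have := hcov G hG S hc
      have := Finset.card_le_card (Finset.inter_subset_left (s₁ := S) (s₂ := V))
      omega
  have hmk' : m ≤ k := by omega
  have hmr : (m : ℝ) ≤ k := by exact_mod_cast hmk'
  induction L generalizing V m D with
  | nil =>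
    -- All pairs are scanned, so the matching is maximal and `V`, with at most `2k` vertices, meets
    -- every edge.
    have h := dualAdversary_of_cover (k := k) hg' V (V ×ˢ Finset.univ).toList ∅ D (by simp) (by simp)
      (by simp) (by simp) (fun G hG v w hvw => by simpa using hscan G hG v w hvw)
      (fun G hG v hv w hvw => by simp [hv])
    refine h.mono ?_
    simp only [Finset.length_toList, Finset.card_product, Finset.card_univ, Fintype.card_fin,
      Finset.card_empty, Nat.cast_zero, sub_zero, List.length_nil, zero_mul, zero_add,
      Nat.cast_mul]
    have hVk : (V.card : ℝ) ≤ 2 * k := by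
      have : V.card ≤ 2 * k := by omega
      exact_mod_cast this
    have h1 : (V.card : ℝ) * n * g' ≤ 2 * k * n * g' := by gcongr
    have h2 : (V.card : ℝ) * (k + 1) * g'⁻¹ ≤ 2 * k * (k + 1) * g'⁻¹ := by gcongr
    have h3 : 0 ≤ ((k : ℝ) + 1 - m) * g⁻¹ := mul_nonneg (by linarith) hgi.le
    linarith
  | cons p L ih =>
    obtain ⟨v, w⟩ := p
    simp only [List.length_cons, Nat.cast_add, Nat.cast_one]
    by_cases hskip : v = w ∨ v ∈ V ∨ w ∈ V
    · refine (ih V m D hm hVm hcov (fun G hG a b hab => ?_) hmk hmk' hmr).mono (by linarith)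
      rcases hscan G hG a b hab with h | h | h
      · exact Or.inl h
      · exact Or.inr (Or.inl h)
      · rcases List.mem_cons.1 h with h | h
        · obtain ⟨rfl, rfl⟩ := Prod.mk.inj h
          rcases hskip with h | h | h
          · exact (G.ne_of_adj hab h).elim
          · exact Or.inl h
          · exact Or.inr (Or.inl h)
        · exact Or.inr (Or.inr h)
    · push Not at hskip
      obtain ⟨hne, hvV, hwV⟩ := hskip
      have hd : ¬ (s(v, w)).IsDiag := by simpa using hne
      have hcov' : ∀ G ∈ {G ∈ D | adjOracle G ⟨s(v, w), hd⟩ = true}, ∀ S : Finset (Fin n),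
          G.IsVertexCover (S : Set (Fin n)) → m + 1 ≤ (S ∩ insert v (insert w V)).card := by
        rintro G ⟨hG, hq⟩ S hS
        rw [adjOracle_mk_eq_true] at hq
        have h1 := hcov G hG S hS
        -- The new edge avoids `V`, so covering it takes one more vertex.
        have h2 : ∃ a ∈ S, a ∉ V ∧ (a = v ∨ a = w) := by
          rcases hS hq with h | h
          · exact ⟨v, h, hvV, Or.inl rfl⟩
          · exact ⟨w, h, hwV, Or.inr rfl⟩
        obtain ⟨a, haS, haV, ha⟩ := h2
        have h3 : insert a (S ∩ V) ⊆ S ∩ insert v (insert w V) := by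
          intro b hb
          simp only [Finset.mem_insert, Finset.mem_inter] at hb ⊢
          rcases hb with rfl | hb
          · exact ⟨haS, ha.elim Or.inl fun h => Or.inr (Or.inl h)⟩
          · exact ⟨hb.1, Or.inr (Or.inr hb.2)⟩
        have h4 := Finset.card_le_card h3
        rw [Finset.card_insert_of_notMem (by simp [haV])] at h4
        omega
      have hscan' : ∀ G ∈ {G ∈ D | adjOracle G ⟨s(v, w), hd⟩ = true}, ∀ a b, G.Adj a b →
          a ∈ insert v (insert w V) ∨ b ∈ insert v (insert w V) ∨ (a, b) ∈ L := by
        rintro G ⟨hG, -⟩ a b hab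
        rcases hscan G hG a b hab with h | h | h
        · exact Or.inl (by simp [h])
        · exact Or.inr (Or.inl (by simp [h]))
        · rcases List.mem_cons.1 h with h | h
          · exact Or.inl (by simp [(Prod.mk.inj h).1])
          · exact Or.inr (Or.inr h)
      have hcard' : (insert v (insert w V)).card ≤ 2 * (m + 1) := by
        have h1 := Finset.card_insert_le v (insert w V)
        have h2 := Finset.card_insert_le w V
        omega
      have hone : DualAdversary adjOracle (HasVertexCoverLE k)
          {G ∈ D | adjOracle G ⟨s(v, w), hd⟩ = true}
          (L.length * g + (k + 1 - (m + 1 : ℕ)) * g⁻¹ +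
            (2 * k * n * g' + 2 * k * (k + 1) * g'⁻¹)) := by
        by_cases hmk1 : m + 1 = k + 1
        · refine DualAdversary.of_const ?_ False fun G hG => ?_
          · have : (0 : ℝ) ≤ L.length * g := by positivity
            rw [hmk1]
            push_cast
            rw [sub_self, zero_mul]
            linarith
          · rw [iff_false]
            rintro ⟨S, hS, hc⟩
            have := hcov' G hG S hc
            have := Finset.card_le_card
              (Finset.inter_subset_left (s₁ := S) (s₂ := insert v (insert w V)))
            omega
        · exact ih _ (m + 1) _ (by omega) hcard' hcov' hscan' hmk1 (by omega)
            (by exact_mod_cast (show m + 1 ≤ k by omega))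
      refine DualAdversary.query ⟨s(v, w), hd⟩ hg
        (ih V m _ hm hVm (fun G hG => hcov G hG.1) ?_ hmk hmk' hmr) hone (by linarith) ?_
      · rintro G ⟨hG, hq⟩ a b hab
        rw [adjOracle_mk_eq_false] at hq
        rcases hscan G hG a b hab with h | h | h
        · exact Or.inl h
        · exact Or.inr (Or.inl h)
        · rcases List.mem_cons.1 h with h | h
          · obtain ⟨rfl, rfl⟩ := Prod.mk.inj h
            exact (hq hab).elim
          · exact Or.inr (Or.inr h)
      · push_cast
        nlinarith

/-- The weights balance zeros against ones: `√k / n` for `n²` zeros and about `k` ones in the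
matching phase, `√k / √n` for `2kn` zeros and about `2k²` ones in the neighbour phase. -/
theorem dualAdversary_hasVertexCoverLE {n k : ℕ} {C : ℝ} (hk : 1 ≤ k) (hn : 1 ≤ n)
    (hC : (k : ℝ) ≤ C * Real.sqrt n) :
    DualAdversary adjOracle (HasVertexCoverLE (n := n) k) Set.univ
      ((3 + 6 * C) * (Real.sqrt k * n)) := by
  have hk' : (1 : ℝ) ≤ k := by exact_mod_cast hk
  have hn' : (1 : ℝ) ≤ n := by exact_mod_cast hn
  have ha : 0 < Real.sqrt k := Real.sqrt_pos.2 (by linarith)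
  have hb : 0 < Real.sqrt n := Real.sqrt_pos.2 (by linarith)
  have hg : 0 < Real.sqrt k / n := by positivity
  have hg' : 0 < Real.sqrt k / Real.sqrt n := by positivity
  have h := dualAdversary_of_matching (k := k) hg hg'
    (Finset.univ : Finset (Fin n × Fin n)).toList ∅ 0 Set.univ (by omega) (by simp) (by simp)
    (by simp)
  refine h.mono ?_
  simp only [Finset.length_toList, Finset.card_univ, Fintype.card_prod, Fintype.card_fin,
    Nat.cast_mul, Nat.cast_zero, sub_zero]
  set a := Real.sqrt k with hadef
  set b := Real.sqrt n with hbdef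
  have hka : (k : ℝ) = a * a := (Real.mul_self_sqrt (by linarith)).symm
  have hnb : (n : ℝ) = b * b := (Real.mul_self_sqrt (by linarith)).symm
  have h1 : (n : ℝ) * n * (a / n) = a * n := by field_simp
  have h2 : ((k : ℝ) + 1) * (a / n)⁻¹ ≤ 2 * (a * n) := by
    calc ((k : ℝ) + 1) * (a / n)⁻¹ ≤ (2 * k) * (a / n)⁻¹ := by gcongr; linarith
      _ = 2 * (a * n) := by rw [hka]; field_simp
  -- The only use of `k ≤ C √n`: the second phase costs a multiple of `k^{3/2} √n`.
  have hab : a * a * (a * b) ≤ C * b * (a * b) := by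
    rw [← hka]; gcongr
  have h3 : 2 * (k : ℝ) * n * (a / b) ≤ 2 * C * (a * n) := by
    calc 2 * (k : ℝ) * n * (a / b) = 2 * (a * a * (a * b)) := by rw [hka, hnb]; field_simp
      _ ≤ 2 * (C * b * (a * b)) := by linarith
      _ = 2 * C * (a * n) := by rw [hnb]; ring
  have h4 : 2 * (k : ℝ) * (k + 1) * (a / b)⁻¹ ≤ 4 * C * (a * n) := by
    calc 2 * (k : ℝ) * (k + 1) * (a / b)⁻¹ ≤ 2 * (k : ℝ) * (2 * k) * (a / b)⁻¹ := by
          gcongr; linarith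
      _ = 4 * (a * a * (a * b)) := by rw [hka]; field_simp; ring
      _ ≤ 4 * (C * b * (a * b)) := by linarith
      _ = 4 * C * (a * n) := by rw [hnb]; ring
  rw [h1]
  linarith

theorem exists_algorithm_hasVertexCoverLE {n k : ℕ} {C : ℝ} (hk : 1 ≤ k) (hn : 2 ≤ n)
    (hC : (k : ℝ) ≤ C * Real.sqrt n) :
    ∃ A : QuantumQueryAlgorithm (VertexPair n), DecidesGraphProperty A (HasVertexCoverLE k) ∧
      (A.queries : ℝ) ≤ 4 * (3 + 6 * C) * (Real.sqrt k * n) := by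
  have hk' : (1 : ℝ) ≤ k := by exact_mod_cast hk
  have hn' : (1 : ℝ) ≤ n := by exact_mod_cast (by omega : 1 ≤ n)
  have hC0 : 0 ≤ C := by
    by_contra hneg
    have := mul_nonpos_of_nonpos_of_nonneg (not_le.1 hneg).le (Real.sqrt_nonneg n)
    linarith
  have hW : 1 ≤ (3 + 6 * C) * (Real.sqrt k * n) := by
    have h1 : 1 ≤ Real.sqrt k := Real.one_le_sqrt.2 hk'
    have h2 : 1 ≤ Real.sqrt k * n := one_le_mul_of_one_le_of_one_le h1 hn'
    exact one_le_mul_of_one_le_of_one_le (by linarith) h2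
  have : Nonempty (VertexPair n) :=
    ⟨⟨s(⟨0, by omega⟩, ⟨1, by omega⟩), by simp⟩⟩
  obtain ⟨A, hA, hdec⟩ := (dualAdversary_hasVertexCoverLE hk (by omega) hC).exists_algorithm hW
    (Nat.le_ceil _)
  refine ⟨A, fun G => ?_, ?_⟩
  · convert hdec G
  · rw [hA]
    have := (Nat.ceil_lt_add_one (show 0 ≤ 3 * ((3 + 6 * C) * (Real.sqrt k * n)) by linarith)).le
    linarith

/-! ### Lower bound: the positive adversary method -/

/-- The real part of the inner product of two state vectors. -/
def overlap {B : Type*} [Fintype B] (ψ φ : B → ℂ) : ℝ := ∑ b, (star (ψ b) * φ b).re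

/-- The probability mass that a state vector puts on the query index `i`. -/
noncomputable def queryMass {ι : Type} [Fintype ι] [DecidableEq ι] {w : ℕ} (i : ι) (ψ : QueryBasis ι w → ℂ) : ℝ :=
  ∑ b, if b.1 = i then ‖ψ b‖ ^ 2 else 0

theorem overlap_unitaryGroup_mulVec {B : Type*} [Fintype B] [DecidableEq B]
    (M : Matrix.unitaryGroup B ℂ) (ψ φ : B → ℂ) :
    overlap ((M : Matrix B B ℂ) *ᵥ ψ) ((M : Matrix B B ℂ) *ᵥ φ) = overlap ψ φ := by
  have key : ∀ ψ φ : B → ℂ, overlap ψ φ = (star ψ ⬝ᵥ φ).re := by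
    intro ψ φ; simp [overlap, dotProduct]
  rw [key, key, Matrix.star_mulVec, Matrix.dotProduct_mulVec, Matrix.vecMul_vecMul,
    ← Matrix.star_eq_conjTranspose, Matrix.UnitaryGroup.star_mul_self, Matrix.vecMul_one]

theorem overlap_self {B : Type*} [Fintype B] (ψ : B → ℂ) : overlap ψ ψ = ∑ b, ‖ψ b‖ ^ 2 := by
  refine Finset.sum_congr rfl fun b _ => ?_
  rw [Complex.star_def, Complex.conj_mul', ← Complex.ofReal_pow, Complex.ofReal_re]

theorem re_star_mul_le (z w : ℂ) : (star z * w).re ≤ ‖z‖ * ‖w‖ := by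
  refine (Complex.re_le_norm _).trans ?_
  rw [norm_mul, norm_star]

theorem neg_re_star_mul_le (z w : ℂ) : -(star z * w).re ≤ ‖z‖ * ‖w‖ := by
  have := re_star_mul_le z (-w)
  simpa using this

section adversary

variable {ι : Type} [Fintype ι] [DecidableEq ι]

theorem queryMass_nonneg {w : ℕ} (i : ι) (ψ : QueryBasis ι w → ℂ) : 0 ≤ queryMass i ψ :=
  Finset.sum_nonneg fun b _ => by split_ifs <;> positivity

theorem sum_queryMass {w : ℕ} (ψ : QueryBasis ι w → ℂ) :
    ∑ i, queryMass i ψ = ∑ b, ‖ψ b‖ ^ 2 := by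
  simp only [queryMass]
  rw [Finset.sum_comm]
  simp

/-- One query changes the overlap of two states only through the index where the inputs differ. -/
theorem overlap_sub_overlap_queryOp_le {w : ℕ} {x y : ι → Bool} {e : ι}
    (hxy : ∀ i, i ≠ e → x i = y i) (ψ φ : QueryBasis ι w → ℂ) {a : ℝ} (ha : 0 < a) :
    overlap ψ φ - overlap (queryOp x ψ) (queryOp y φ) ≤
      a * queryMass e ψ + a⁻¹ * queryMass e φ := by
  -- Undoing the query to `x` on both states leaves a query to `z`, which is trivial at every index
  -- except `e`.
  set z : ι → Bool := fun i => xor (x i) (y i) with hz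
  have h1 : overlap (queryOp x ψ) (queryOp y φ) = overlap ψ (queryOp z φ) := by
    simp only [overlap]
    rw [← Equiv.sum_comp (bitOraclePerm x)]
    refine Finset.sum_congr rfl fun b _ => ?_
    simp [queryOp, bitOraclePerm, hz]
  have h2 : queryMass e (queryOp z φ) = queryMass e φ :=
    Equiv.sum_comp (bitOraclePerm z) fun b => if b.1 = e then ‖φ b‖ ^ 2 else 0
  have hai : 0 < a⁻¹ := inv_pos.2 ha
  have hsplit : ∀ s t : ℝ, s * t ≤ a / 2 * s ^ 2 + a⁻¹ / 2 * t ^ 2 := by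
    intro s t
    have h := sq_nonneg (a * s - t)
    have : a⁻¹ * (a * s - t) ^ 2 = a * s ^ 2 - 2 * (s * t) + a⁻¹ * t ^ 2 := by field_simp; ring
    have := mul_nonneg hai.le h
    linarith
  have h3 : overlap ψ φ - overlap ψ (queryOp z φ) ≤
      a * queryMass e ψ + (a⁻¹ / 2 * queryMass e φ + a⁻¹ / 2 * queryMass e (queryOp z φ)) := by
    simp only [overlap, queryMass, Finset.mul_sum]
    rw [← Finset.sum_sub_distrib, ← Finset.sum_add_distrib, ← Finset.sum_add_distrib]
    refine Finset.sum_le_sum fun b _ => ?_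
    by_cases hb : b.1 = e
    · simp only [hb, if_true]
      have h4 := (re_star_mul_le (ψ b) (φ b)).trans (hsplit _ _)
      have h5 := (neg_re_star_mul_le (ψ b) (queryOp z φ b)).trans (hsplit _ _)
      linarith
    · simp [hb, queryOp, hz, hxy b.1 hb]
  rw [h1]
  rw [h2] at h3
  linarith

namespace QuantumQueryAlgorithm

/-- Final states that are distinguished with error at most `1/3` have bounded overlap. -/
theorem overlap_final_le (A : QuantumQueryAlgorithm ι) {x y : ι → Bool}
    (hx : 2 / 3 ≤ A.answerProb x true) (hy : 2 / 3 ≤ A.answerProb y false) :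
    overlap (A.state x A.queries) (A.state y A.queries) ≤ 17 / 18 := by
  have hx' := A.answerProb_true_add_false x
  have hy' := A.answerProb_true_add_false y
  -- Weighted AM–GM, `s t ≤ s²/3 + 3t²/4`, with the smaller weight on the likely answer. Each input
  -- then contributes at most `1/3 * 2/3 + 3/4 * 1/3 = 17/36`.
  have h : overlap (A.state x A.queries) (A.state y A.queries) ≤
      1 / 3 * A.answerProb x true + 3 / 4 * A.answerProb x false +
        (3 / 4 * A.answerProb y true + 1 / 3 * A.answerProb y false) := by
    simp only [overlap, answerProb, Finset.mul_sum, ← Finset.sum_add_distrib]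
    refine Finset.sum_le_sum fun b _ => (re_star_mul_le _ _).trans ?_
    set s := ‖A.state x A.queries b‖
    set t := ‖A.state y A.queries b‖
    cases A.output b
    · simp only [Bool.false_eq_true, if_false, if_true]
      nlinarith [sq_nonneg (3 * s - 2 * t)]
    · simp only [Bool.true_eq_false, if_false, if_true]
      nlinarith [sq_nonneg (2 * s - 3 * t)]
  linarith

/-- The positive adversary bound for pairs of inputs that differ in a single index. -/
theorem card_le_queries_mul (A : QuantumQueryAlgorithm ι) {ρ ξ : Type*} [DecidableEq ξ]
    (R : Finset ρ) (o : ξ → ι → Bool) (x y : ρ → ξ) (e : ρ → ι) (X Y : Finset ξ)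
    (hdiff : ∀ r ∈ R, ∀ i, i ≠ e r → o (x r) i = o (y r) i)
    (hX : ∀ r ∈ R, x r ∈ X) (hY : ∀ r ∈ R, y r ∈ Y)
    (hxe : Set.InjOn (fun r => (x r, e r)) R) (hye : Set.InjOn (fun r => (y r, e r)) R)
    (hx : ∀ r ∈ R, 2 / 3 ≤ A.answerProb (o (x r)) true)
    (hy : ∀ r ∈ R, 2 / 3 ≤ A.answerProb (o (y r)) false) {a : ℝ} (ha : 0 < a) :
    (R.card : ℝ) / 18 ≤ A.queries * (a * X.card + a⁻¹ * Y.card) := by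
  have hai : 0 < a⁻¹ := inv_pos.2 ha
  -- By injectivity no pair of an input and an index is counted twice, so each input contributes at
  -- most its total mass `1`.
  have hmass : ∀ (z : ρ → ξ) (Z : Finset ξ), (∀ r ∈ R, z r ∈ Z) →
      Set.InjOn (fun r => (z r, e r)) R → ∀ t : ℕ,
      ∑ r ∈ R, queryMass (e r) (A.state (o (z r)) t) ≤ Z.card := by
    intro z Z hZ hinj t
    calc ∑ r ∈ R, queryMass (e r) (A.state (o (z r)) t)
        = ∑ p ∈ R.image (fun r => (z r, e r)), queryMass p.2 (A.state (o p.1) t) := by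
          rw [Finset.sum_image hinj]
      _ ≤ ∑ p ∈ Z ×ˢ Finset.univ, queryMass p.2 (A.state (o p.1) t) := by
          refine Finset.sum_le_sum_of_subset_of_nonneg ?_ fun _ _ _ => queryMass_nonneg _ _
          intro p hp
          obtain ⟨r, hr, rfl⟩ := Finset.mem_image.1 hp
          simp [hZ r hr]
      _ = Z.card := by
          rw [Finset.sum_product]
          simp [sum_queryMass, sum_norm_sq_state]
  have hprog : ∀ t : ℕ, (R.card : ℝ) - ∑ r ∈ R, overlap (A.state (o (x r)) t)
      (A.state (o (y r)) t) ≤ t * (a * X.card + a⁻¹ * Y.card) := by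
    intro t
    induction t with
    | zero =>
      have : ∀ r ∈ R, overlap (A.state (o (x r)) 0) (A.state (o (y r)) 0) = 1 := fun r _ => by
        rw [← A.sum_norm_sq_state (o (x r)) 0, ← overlap_self]
        rfl
      rw [Finset.sum_congr rfl this]
      simp
    | succ t ih =>
      have h1 : ∑ r ∈ R, overlap (A.state (o (x r)) t) (A.state (o (y r)) t) -
          ∑ r ∈ R, overlap (A.state (o (x r)) (t + 1)) (A.state (o (y r)) (t + 1)) ≤
          a * X.card + a⁻¹ * Y.card := by
        calc _ ≤ ∑ r ∈ R, (a * queryMass (e r) (A.state (o (x r)) t) +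
              a⁻¹ * queryMass (e r) (A.state (o (y r)) t)) := by
              rw [← Finset.sum_sub_distrib]
              refine Finset.sum_le_sum fun r hr => ?_
              simp only [state]
              rw [overlap_unitaryGroup_mulVec]
              exact overlap_sub_overlap_queryOp_le (hdiff r hr) _ _ ha
          _ ≤ _ := by
              rw [Finset.sum_add_distrib, ← Finset.mul_sum, ← Finset.mul_sum]
              exact add_le_add (mul_le_mul_of_nonneg_left (hmass x X hX hxe t) ha.le)
                (mul_le_mul_of_nonneg_left (hmass y Y hY hye t) hai.le)
      push_cast
      linarith
  have h2 : ∑ r ∈ R, overlap (A.state (o (x r)) A.queries) (A.state (o (y r)) A.queries) ≤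
      ∑ _r ∈ R, (17 / 18 : ℝ) :=
    Finset.sum_le_sum fun r hr => A.overlap_final_le (hx r hr) (hy r hr)
  rw [Finset.sum_const, nsmul_eq_mul] at h2
  have := hprog A.queries
  linarith

end QuantumQueryAlgorithm

end adversary

/-! ### Hard instances: matchings with `k` and `k + 1` edges -/

section matchings

variable {n : ℕ}

/-- A set of pairwise disjoint vertex pairs. -/
def IsPairMatching (M : Finset (VertexPair n)) : Prop :=
  ∀ e ∈ M, ∀ e' ∈ M, e ≠ e' → ∀ v, v ∈ e.1 → v ∉ e'.1

open Classical in
/-- The matchings with `k` edges. -/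
noncomputable def matchingsOfCard (n k : ℕ) : Finset (Finset (VertexPair n)) :=
  Finset.univ.filter fun M => M.card = k ∧ IsPairMatching M

open Classical in
/-- The vertex pairs that are disjoint from all pairs of `M`. -/
noncomputable def disjointPairs (M : Finset (VertexPair n)) : Finset (VertexPair n) :=
  Finset.univ.filter fun e => ∀ e' ∈ M, ∀ v, v ∈ e.1 → v ∉ e'.1

theorem mem_matchingsOfCard {k : ℕ} {M : Finset (VertexPair n)} :
    M ∈ matchingsOfCard n k ↔ M.card = k ∧ IsPairMatching M := by
  simp [matchingsOfCard]

theorem mem_disjointPairs {M : Finset (VertexPair n)} {e : VertexPair n} :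
    e ∈ disjointPairs M ↔ ∀ e' ∈ M, ∀ v, v ∈ e.1 → v ∉ e'.1 := by
  simp [disjointPairs]

theorem notMem_of_mem_disjointPairs {M : Finset (VertexPair n)} {e : VertexPair n}
    (he : e ∈ disjointPairs M) : e ∉ M := fun h =>
  mem_disjointPairs.1 he e h _ (Sym2.out_fst_mem e.1) (Sym2.out_fst_mem e.1)

theorem insert_mem_matchingsOfCard {k : ℕ} {M : Finset (VertexPair n)} {e : VertexPair n}
    (hM : M ∈ matchingsOfCard n k) (he : e ∈ disjointPairs M) :
    insert e M ∈ matchingsOfCard n (k + 1) := by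
  obtain ⟨hc, hm⟩ := mem_matchingsOfCard.1 hM
  refine mem_matchingsOfCard.2 ⟨?_, ?_⟩
  · rw [Finset.card_insert_of_notMem (notMem_of_mem_disjointPairs he), hc]
  · intro a ha b hb hab v hva hvb
    rcases Finset.mem_insert.1 ha with rfl | h <;> rcases Finset.mem_insert.1 hb with rfl | h'
    · exact hab rfl
    · exact mem_disjointPairs.1 he b h' v hva hvb
    · exact mem_disjointPairs.1 he a h v hvb hva
    · exact hm a h b h' hab v hva hvb

theorem erase_mem_matchingsOfCard {k : ℕ} {M : Finset (VertexPair n)} {e : VertexPair n}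
    (hM : M ∈ matchingsOfCard n (k + 1)) (he : e ∈ M) : M.erase e ∈ matchingsOfCard n k := by
  obtain ⟨hc, hm⟩ := mem_matchingsOfCard.1 hM
  refine mem_matchingsOfCard.2 ⟨by rw [Finset.card_erase_of_mem he, hc]; rfl, ?_⟩
  exact fun a ha b hb => hm a (Finset.mem_of_mem_erase ha) b (Finset.mem_of_mem_erase hb)

/-- `M` touches at most `2 * M.card` vertices, and any pair of the remaining ones qualifies. -/
theorem choose_two_le_card_disjointPairs (M : Finset (VertexPair n)) :
    (n - 2 * M.card).choose 2 ≤ (disjointPairs M).card := by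
  classical
  set V : Finset (Fin n) := M.biUnion fun e => e.1.toFinset with hV
  have hVc : V.card ≤ 2 * M.card := by
    refine (Finset.card_biUnion_le_card_mul _ _ 2 fun e _ => ?_).trans (by rw [mul_comm])
    rw [Sym2.card_toFinset]
    split_ifs <;> omega
  have h1 : n - 2 * M.card ≤ Vᶜ.card := by
    rw [Finset.card_compl, Fintype.card_fin]; omega
  refine (Nat.choose_le_choose 2 h1).trans ?_
  rw [← Sym2.card_image_offDiag]
  refine le_trans (Finset.card_le_card ?_)
    (Finset.card_image_le (s := disjointPairs M) (f := Subtype.val))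
  intro s hs
  obtain ⟨⟨a, b⟩, hab, rfl⟩ := Finset.mem_image.1 hs
  obtain ⟨ha, hb, hne⟩ := Finset.mem_offDiag.1 hab
  refine Finset.mem_image.2 ⟨⟨s(a, b), by simpa using hne⟩, ?_, rfl⟩
  rw [mem_disjointPairs]
  intro e' he' v hv hve'
  have hvV : v ∈ V := Finset.mem_biUnion.2 ⟨e', he', by simpa using hve'⟩
  rcases Sym2.mem_iff.1 hv with rfl | rfl
  · exact Finset.mem_compl.1 ha hvV
  · exact Finset.mem_compl.1 hb hvV

theorem matchingsOfCard_nonempty {k : ℕ} (hk : 2 * k ≤ n) : (matchingsOfCard n k).Nonempty := by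
  induction k with
  | zero => exact ⟨∅, mem_matchingsOfCard.2 ⟨rfl, fun e he => by simp at he⟩⟩
  | succ k ih =>
    obtain ⟨M, hM⟩ := ih (by omega)
    have h1 := choose_two_le_card_disjointPairs M
    rw [(mem_matchingsOfCard.1 hM).1] at h1
    have h2 : 0 < (n - 2 * k).choose 2 := Nat.choose_pos (by omega)
    obtain ⟨e, he⟩ := Finset.card_pos.1 (h2.trans_le h1)
    exact ⟨_, insert_mem_matchingsOfCard hM he⟩

/-- The graph with the given edges. -/
def graphOfPairs (M : Finset (VertexPair n)) : SimpleGraph (Fin n) :=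
  SimpleGraph.fromEdgeSet {s | ∃ e ∈ M, e.1 = s}

theorem graphOfPairs_adj {M : Finset (VertexPair n)} {v w : Fin n} :
    (graphOfPairs M).Adj v w ↔ ∃ e ∈ M, e.1 = s(v, w) := by
  rw [graphOfPairs, SimpleGraph.fromEdgeSet_adj]
  refine ⟨fun h => h.1, fun h => ⟨h, ?_⟩⟩
  obtain ⟨e, -, he⟩ := h
  have := e.2
  rw [he] at this
  simpa using this

theorem adjOracle_graphOfPairs_eq_true {M : Finset (VertexPair n)} {e : VertexPair n} :
    adjOracle (graphOfPairs M) e = true ↔ e ∈ M := by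
  obtain ⟨s, hs⟩ := e
  induction s with
  | _ v w =>
    rw [adjOracle_mk_eq_true, graphOfPairs_adj]
    exact ⟨fun ⟨e, he, h⟩ => (Subtype.ext h : e = ⟨s(v, w), hs⟩) ▸ he, fun h => ⟨_, h, rfl⟩⟩

theorem hasVertexCoverLE_graphOfPairs (M : Finset (VertexPair n)) :
    HasVertexCoverLE M.card (graphOfPairs M) := by
  classical
  refine ⟨M.image fun e => (Quot.out e.1).1, Finset.card_image_le, fun v w hvw => ?_⟩
  obtain ⟨e, he, h⟩ := graphOfPairs_adj.1 hvw
  have h1 := Sym2.out_fst_mem e.1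
  have h2 : (Quot.out e.1).1 ∈ M.image fun e => (Quot.out e.1).1 :=
    Finset.mem_image_of_mem (fun e : VertexPair n => (Quot.out e.1).1) he
  rw [h] at h1
  rcases Sym2.mem_iff.1 h1 with h3 | h3
  · rw [h, h3] at h2; exact Or.inl h2
  · rw [h, h3] at h2; exact Or.inr h2

/-- Disjoint edges need distinct cover vertices. -/
theorem IsPairMatching.card_le_of_hasVertexCoverLE {M : Finset (VertexPair n)}
    (hM : IsPairMatching M) {k : ℕ} (h : HasVertexCoverLE k (graphOfPairs M)) : M.card ≤ k := by
  obtain ⟨S, hS, hc⟩ := h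
  have hex : ∀ e : VertexPair n, ∃ v, e ∈ M → v ∈ S ∧ v ∈ e.1 := by
    rintro ⟨s, hs⟩
    induction s with
    | _ v w =>
      by_cases he : (⟨s(v, w), hs⟩ : VertexPair n) ∈ M
      · rcases hc (graphOfPairs_adj.2 ⟨_, he, rfl⟩) with h | h
        · exact ⟨v, fun _ => ⟨h, by simp⟩⟩
        · exact ⟨w, fun _ => ⟨h, by simp⟩⟩
      · exact ⟨v, fun h => (he h).elim⟩
  choose g hg using hex
  refine le_trans (Finset.card_le_card_of_injOn g (fun e he => (hg e he).1) ?_) hS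
  intro a ha b hb hab
  by_contra hne
  exact hM a ha b hb hne (g a) (hg a ha).2 (by rw [hab]; exact (hg b hb).2)

/-- Each `k`-matching extends in at least `n² / 16` ways and each `(k + 1)`-matching shrinks in `k +
1` ways, so the adversary ratio is of order `√(n² k)`. -/
theorem queries_ge_of_decides {k : ℕ} (hk : 1 ≤ k) (hn4 : 4 ≤ n) (hnk : 4 * k ≤ n)
    (A : QuantumQueryAlgorithm (VertexPair n)) (hA : DecidesGraphProperty A (HasVertexCoverLE k)) :
    Real.sqrt k * n / 306 ≤ A.queries := by
  classical
  set X := matchingsOfCard n k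
  set Y := matchingsOfCard n (k + 1)
  let R : Finset (Σ _ : Finset (VertexPair n), VertexPair n) := Y.sigma fun M => M
  have hR : ∀ r ∈ R, r.1 ∈ Y ∧ r.2 ∈ r.1 := fun r hr => Finset.mem_sigma.1 hr
  have hRY : R.card = (k + 1) * Y.card := by
    rw [Finset.card_sigma, Finset.sum_congr rfl fun M hM => (mem_matchingsOfCard.1 hM).1,
      Finset.sum_const, smul_eq_mul, mul_comm]
  have hRX : X.card * (n - 2 * k).choose 2 ≤ R.card := by
    calc X.card * (n - 2 * k).choose 2 ≤ (X.sigma disjointPairs).card := by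
          rw [Finset.card_sigma, ← smul_eq_mul, ← Finset.sum_const]
          refine Finset.sum_le_sum fun M hM => ?_
          have := choose_two_le_card_disjointPairs M
          rwa [(mem_matchingsOfCard.1 hM).1] at this
      _ ≤ R.card := by
          refine Finset.card_le_card_of_injOn (fun p => ⟨insert p.2 p.1, p.2⟩) ?_ ?_
          · intro p hp
            obtain ⟨hp1, hp2⟩ := Finset.mem_sigma.1 hp
            exact Finset.mem_sigma.2
              ⟨insert_mem_matchingsOfCard hp1 hp2, Finset.mem_insert_self _ _⟩
          · rintro ⟨M, e⟩ hp ⟨M', e'⟩ hp' h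
            simp only [Sigma.mk.injEq, heq_eq_eq] at h ⊢
            obtain ⟨h, rfl⟩ := h
            refine ⟨?_, rfl⟩
            have h1 : e ∉ M := notMem_of_mem_disjointPairs (Finset.mem_sigma.1 hp).2
            have h2 : e ∉ M' := notMem_of_mem_disjointPairs (Finset.mem_sigma.1 hp').2
            rw [← Finset.erase_insert h1, ← Finset.erase_insert h2, h]
  have hYpos : 0 < Y.card := Finset.card_pos.2 (matchingsOfCard_nonempty (by omega))
  have hkr : (1 : ℝ) ≤ k := by exact_mod_cast hk
  have hnr : (4 : ℝ) ≤ n := by exact_mod_cast hn4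
  have hnkr : (4 : ℝ) * k ≤ n := by exact_mod_cast hnk
  have hs : 0 < Real.sqrt k := Real.sqrt_pos.2 (by linarith)
  -- This weight balances the two sides: they are at most `16` and `1` times `R.card / (√k n)`, and
  -- `306 = 17 * 18`.
  have ha : 0 < n / Real.sqrt k := by positivity
  have hmain := A.card_le_queries_mul R (fun M => adjOracle (graphOfPairs M))
    (fun r => r.1.erase r.2) (fun r => r.1) (fun r => r.2) X Y ?_ ?_ ?_ ?_ ?_ ?_ ?_ ha
  · have hRr : (R.card : ℝ) = (k + 1) * Y.card := by exact_mod_cast hRY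
    have hRpos : (0 : ℝ) < R.card := by
      rw [hRr]
      have : (0 : ℝ) < Y.card := by exact_mod_cast hYpos
      positivity
    have hchoose : (n : ℝ) ^ 2 / 16 ≤ ((n - 2 * k).choose 2 : ℕ) := by
      rw [Nat.cast_choose_two, Nat.cast_sub (by omega)]
      push_cast
      nlinarith
    have hXr : (X.card : ℝ) * (n ^ 2 / 16) ≤ R.card := by
      have : (X.card : ℝ) * ((n - 2 * k).choose 2 : ℕ) ≤ R.card := by exact_mod_cast hRX
      exact (mul_le_mul_of_nonneg_left hchoose (by positivity)).trans this
    have hkk : Real.sqrt k * Real.sqrt k = k := Real.mul_self_sqrt (by linarith)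
    have h1 : n / Real.sqrt k * X.card ≤ 16 * R.card / (Real.sqrt k * n) := by
      rw [le_div_iff₀ (by positivity)]
      have : n / Real.sqrt k * X.card * (Real.sqrt k * n) = 16 * (X.card * (n ^ 2 / 16)) := by
        field_simp
      linarith
    have h2 : (n / Real.sqrt k)⁻¹ * Y.card ≤ R.card / (Real.sqrt k * n) := by
      rw [le_div_iff₀ (by positivity), hRr]
      have : (n / Real.sqrt k)⁻¹ * Y.card * (Real.sqrt k * n) = Real.sqrt k * Real.sqrt k * Y.card := by
        field_simp
      rw [this, hkk]
      have : (0 : ℝ) ≤ Y.card := by positivity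
      linarith
    have h3 : (R.card : ℝ) / 18 ≤ A.queries * (17 * R.card / (Real.sqrt k * n)) := by
      refine hmain.trans (mul_le_mul_of_nonneg_left ?_ (by positivity))
      have : 17 * (R.card : ℝ) / (Real.sqrt k * n) =
        16 * R.card / (Real.sqrt k * n) + R.card / (Real.sqrt k * n) := by ring
      linarith
    rw [← mul_div_assoc, le_div_iff₀ (by positivity)] at h3
    have h4 : (R.card : ℝ) * (Real.sqrt k * n) ≤ R.card * (306 * A.queries) := by linarith
    have := le_of_mul_le_mul_left h4 hRpos
    linarith
  · intro r hr i hi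
    rw [Bool.eq_iff_iff, adjOracle_graphOfPairs_eq_true, adjOracle_graphOfPairs_eq_true]
    simp [hi]
  · exact fun r hr => erase_mem_matchingsOfCard (hR r hr).1 (hR r hr).2
  · exact fun r hr => (hR r hr).1
  · rintro ⟨M, e⟩ hr ⟨M', e'⟩ hr' h
    simp only [Prod.mk.injEq] at h
    obtain ⟨h, rfl⟩ := h
    have h1 : e ∈ M := (hR _ hr).2
    have h2 : e ∈ M' := (hR _ hr').2
    rw [← Finset.insert_erase h1, ← Finset.insert_erase h2, h]
  · rintro ⟨M, e⟩ hr ⟨M', e'⟩ hr' h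
    simp only [Prod.mk.injEq] at h
    rw [h.1, h.2]
  · intro r hr
    have h := hA (graphOfPairs (r.1.erase r.2))
    have hc := (mem_matchingsOfCard.1 (erase_mem_matchingsOfCard (hR r hr).1 (hR r hr).2)).1
    have h1 := hasVertexCoverLE_graphOfPairs (r.1.erase r.2)
    rw [hc] at h1
    rwa [decide_eq_true h1] at h
  · intro r hr
    have h := hA (graphOfPairs r.1)
    obtain ⟨hc, hm⟩ := mem_matchingsOfCard.1 (hR r hr).1
    have h1 : ¬ HasVertexCoverLE k (graphOfPairs r.1) := fun h' => by
      have := hm.card_le_of_hasVertexCoverLE h'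
      omega
    rwa [decide_eq_false h1] at h

/-- Without queries the empty and the complete graph give the same final state, yet need different
answers. -/
theorem queries_pos_of_decides {k : ℕ} (hk : k + 1 < n)
    (A : QuantumQueryAlgorithm (VertexPair n)) (hA : DecidesGraphProperty A (HasVertexCoverLE k)) :
    1 ≤ A.queries := by
  classical
  by_contra h0
  have hq : A.queries = 0 := by omega
  have hbot : HasVertexCoverLE k (⊥ : SimpleGraph (Fin n)) := ⟨∅, by simp, by simp⟩
  have htop : ¬ HasVertexCoverLE k (⊤ : SimpleGraph (Fin n)) := by
    rintro ⟨S, hS, hc⟩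
    have : 1 < Sᶜ.card := by rw [Finset.card_compl, Fintype.card_fin]; omega
    obtain ⟨a, ha, b, hb, hab⟩ := Finset.one_lt_card.1 this
    rcases hc (show (⊤ : SimpleGraph (Fin n)).Adj a b from hab) with h | h
    · exact Finset.mem_compl.1 ha h
    · exact Finset.mem_compl.1 hb h
  have h1 := hA ⊥
  have h2 := hA ⊤
  rw [decide_eq_true hbot] at h1
  rw [decide_eq_false htop] at h2
  have h3 := A.answerProb_true_add_false (adjOracle ⊤)
  have h4 : A.answerProb (adjOracle ⊥) true = A.answerProb (adjOracle ⊤) true := by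
    simp only [QuantumQueryAlgorithm.answerProb, hq]
    rfl
  linarith

end matchings

/-! ### Complementation and cliques -/

/-- An algorithm can be run on the complemented input without additional queries. -/
theorem QuantumQueryAlgorithm.exists_answerProb_not {ι : Type} [Fintype ι] [DecidableEq ι]
    (A : QuantumQueryAlgorithm ι) : ∃ A' : QuantumQueryAlgorithm ι, A'.queries = A.queries ∧
      ∀ x a, A'.answerProb x a = A.answerProb (fun i => !x i) a := by
  -- `N` flips the target bit; absorbed into the unitary after each query, it turns `x i` into its
  -- negation.
  obtain ⟨N, hN⟩ := (LinearIsometryEquiv.piLpCongrLeft 2 ℂ ℂ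
    (bitOraclePerm (κ := Fin A.w) fun _ : ι => true)).exists_unitaryGroup_mulVec
  have hN' : ∀ (x : ι → Bool) (ψ : QueryBasis ι A.w → ℂ),
      (N : Matrix _ _ ℂ) *ᵥ queryOp x ψ = queryOp (fun i => !x i) ψ := by
    intro x ψ
    rw [hN]
    funext ⟨i, q, z⟩
    change queryOp x ψ (i, xor q true, z) = _
    simp [queryOp]
  let A' : QuantumQueryAlgorithm ι :=
    { A with U := fun t => match t with
        | 0 => A.U 0
        | t + 1 => A.U (t + 1) * N }
  have hst : ∀ x t, A'.state x t = A.state (fun i => !x i) t := by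
    intro x t
    induction t with
    | zero => rfl
    | succ t ih =>
      change Matrix.mulVec (A.U (t + 1) * N).1 (queryOp x (A'.state x t)) = _
      rw [ih, Matrix.UnitaryGroup.mul_val, ← Matrix.mulVec_mulVec, hN']
      rfl
  refine ⟨A', rfl, fun x a => ?_⟩
  change (∑ b, if A.output b = a then ‖A'.state x A.queries b‖ ^ 2 else 0) = _
  rw [hst]
  rfl

theorem adjOracle_compl {n : ℕ} (G : SimpleGraph (Fin n)) :
    adjOracle Gᶜ = fun e => !adjOracle G e := by
  funext ⟨s, hs⟩
  induction s with
  | _ v w =>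
    have hne : v ≠ w := by simpa using hs
    rw [Bool.eq_iff_iff, adjOracle_mk_eq_true, Bool.not_eq_true', adjOracle_mk_eq_false,
      SimpleGraph.compl_adj]
    simp [hne]

theorem hasVertexCoverLE_compl_iff {n k : ℕ} (G : SimpleGraph (Fin n)) :
    HasVertexCoverLE k Gᶜ ↔ HasCliqueGE (n - k) G := by
  constructor
  · rintro ⟨S, hS, hc⟩
    refine ⟨Sᶜ, by rw [Finset.card_compl, Fintype.card_fin]; omega, ?_⟩
    rw [Finset.coe_compl, ← SimpleGraph.isIndepSet_compl,
      SimpleGraph.isIndepSet_compl_iff_isVertexCover]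
    exact hc
  · rintro ⟨S, hS, hc⟩
    refine ⟨Sᶜ, by rw [Finset.card_compl, Fintype.card_fin]; omega, ?_⟩
    rw [Finset.coe_compl, SimpleGraph.isVertexCover_compl, SimpleGraph.isIndepSet_compl]
    exact hc

theorem exists_decides_of_compl {n : ℕ} {P Q : SimpleGraph (Fin n) → Prop}
    (hPQ : ∀ G, P Gᶜ ↔ Q G) {T : ℕ}
    (h : ∃ A : QuantumQueryAlgorithm (VertexPair n), A.queries = T ∧ DecidesGraphProperty A P) :
    ∃ A : QuantumQueryAlgorithm (VertexPair n), A.queries = T ∧ DecidesGraphProperty A Q := by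
  obtain ⟨A, hT, hA⟩ := h
  obtain ⟨A', hq, hp⟩ := A.exists_answerProb_not
  refine ⟨A', hq.trans hT, fun G => ?_⟩
  have h := hA Gᶜ
  rw [hp, ← adjOracle_compl]
  rwa [propext (hPQ G)] at h

theorem quantumQueryComplexity_hasCliqueGE (n k : ℕ) :
    quantumQueryComplexity (n := n) (HasCliqueGE (n - k)) =
      quantumQueryComplexity (n := n) (HasVertexCoverLE k) := by
  unfold quantumQueryComplexity
  congr 1
  ext T
  exact ⟨exists_decides_of_compl fun G => by rw [← hasVertexCoverLE_compl_iff, compl_compl],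
    exists_decides_of_compl fun G => hasVertexCoverLE_compl_iff G⟩

/-! ### Assembling the two bounds -/

theorem quantumQueryComplexity_spec {n : ℕ} {P : SimpleGraph (Fin n) → Prop}
    (h : ∃ A : QuantumQueryAlgorithm (VertexPair n), DecidesGraphProperty A P) :
    ∃ A : QuantumQueryAlgorithm (VertexPair n),
      A.queries = quantumQueryComplexity P ∧ DecidesGraphProperty A P := by
  obtain ⟨A, hA⟩ := h
  exact Nat.sInf_mem (s := {T : ℕ | ∃ A : QuantumQueryAlgorithm (VertexPair n),
    A.queries = T ∧ DecidesGraphProperty A P}) ⟨_, A, rfl, hA⟩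

theorem corollary3 (C : ℝ) :
    ∃ c₁ c₂ : ℝ, 0 < c₁ ∧ 0 < c₂ ∧
      ∀ n k : ℕ, 1 ≤ k → k + 1 < n → (k : ℝ) ≤ C * Real.sqrt (n : ℝ) →
        (c₁ * (Real.sqrt (k : ℝ) * (n : ℝ)) ≤
            (quantumQueryComplexity (n := n) (HasVertexCoverLE k) : ℝ) ∧
          (quantumQueryComplexity (n := n) (HasVertexCoverLE k) : ℝ) ≤
            c₂ * (Real.sqrt (k : ℝ) * (n : ℝ))) ∧
        (c₁ * (Real.sqrt (k : ℝ) * (n : ℝ)) ≤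
            (quantumQueryComplexity (n := n) (HasCliqueGE (n - k)) : ℝ) ∧
          (quantumQueryComplexity (n := n) (HasCliqueGE (n - k)) : ℝ) ≤
            c₂ * (Real.sqrt (k : ℝ) * (n : ℝ))) := by
  -- The second entry of the minimum serves the case `n ≤ 16 C² + 4`, where `√k n ≤ n²` is bounded.
  -- The absolute value keeps the upper constant positive for negative `C`.
  refine ⟨min (1 / 306) (1 / (16 * C ^ 2 + 4) ^ 2), 4 * (3 + 6 * |C|),
    lt_min (by norm_num) (by positivity), by positivity, fun n k hk hkn hC => ?_⟩
  rw [quantumQueryComplexity_hasCliqueGE, and_self_iff]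
  have hkr : (1 : ℝ) ≤ k := by exact_mod_cast hk
  have hknr : (k : ℝ) ≤ n := by exact_mod_cast (by omega : k ≤ n)
  obtain ⟨A₀, hA₀, hle⟩ := exists_algorithm_hasVertexCoverLE hk (by omega) hC
  constructor
  · obtain ⟨A, hq, hA⟩ := quantumQueryComplexity_spec ⟨A₀, hA₀⟩
    rw [← hq]
    by_cases hbig : 4 ≤ n ∧ 4 * k ≤ n
    · refine le_trans ?_ (queries_ge_of_decides hk hbig.1 hbig.2 A hA)
      calc _ ≤ 1 / 306 * (Real.sqrt k * n) := by gcongr; exact min_le_left _ _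
        _ = _ := by ring
    · have h1 : (1 : ℝ) ≤ A.queries := by exact_mod_cast queries_pos_of_decides hkn A hA
      refine le_trans ?_ h1
      -- If `n < 4k`, then `k ≤ C √n` gives `√n < 4C`.
      have hn : (n : ℝ) ≤ 16 * C ^ 2 + 4 := by
        by_cases h4 : 4 ≤ n
        · have h5 : (n : ℝ) < 4 * k := by
            exact_mod_cast (by by_contra h; exact hbig ⟨h4, by omega⟩ : n < 4 * k)
          have h6 : Real.sqrt n * Real.sqrt n = n := Real.mul_self_sqrt (by linarith)
          have h7 : 0 < Real.sqrt n := Real.sqrt_pos.2 (by linarith)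
          have h8 : Real.sqrt n < 4 * C := by
            by_contra h
            have := mul_le_mul_of_nonneg_right (not_lt.1 h) h7.le
            linarith
          nlinarith
        · have : (n : ℝ) ≤ 4 := by exact_mod_cast (by omega : n ≤ 4)
          nlinarith [sq_nonneg C]
      have hsk : Real.sqrt k ≤ n := by
        refine (Real.sqrt_le_left (by linarith)).2 ?_
        nlinarith
      calc _ ≤ 1 / (16 * C ^ 2 + 4) ^ 2 * ((16 * C ^ 2 + 4) * (16 * C ^ 2 + 4)) := by
            gcongr
            · exact min_le_right _ _
            · exact hsk.trans hn
        _ = 1 := by field_simp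
  · have h1 : quantumQueryComplexity (n := n) (HasVertexCoverLE k) ≤ A₀.queries :=
      Nat.sInf_le ⟨A₀, rfl, hA₀⟩
    have h2 : (quantumQueryComplexity (n := n) (HasVertexCoverLE k) : ℝ) ≤ A₀.queries := by
      exact_mod_cast h1
    refine h2.trans (hle.trans ?_)
    gcongr
    exact le_abs_self C
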